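/- **Theorem (fully smooth bipartite economical convex split).** All Hilbert spaces are finite dimensional and all logarithms are to base $2$. A *subnormalised density matrix* is a positive semidefinite matrix with trace at most one. Write $\|T\|_1:=\mathrm{Tr}\,(T^\dagger T)^{1/2}$, $\|T\|_2:=(\mathrm{Tr}\,T^\dagger T)^{1/2}$. For a subnormalised density matrix $\alpha$ and a positive semidefinite matrix $\beta$ on the same space let $$D_2(\alpha\|\beta):=2\log\|\beta^{-1/4}\alpha\beta^{-1/4}\|_2\ \text{ if } \mathrm{supp}(\alpha)\subseteq\mathrm{supp}(\beta),\qquad D_2(\alpha\|\beta):=+\infty\ \text{ otherwise},$$ with negative powers taken on the support of $\beta$, and let $D_2^\epsilon(\alpha\|\beta):=\min_{\alpha'}D_2(\alpha'\|\beta)$, the minimum being over all subnormalised density matrices $\alpha'$ with $\|\alpha'-\alpha\|_1\le\epsilon\,\mathrm{Tr}\,\alpha$. Let $\mu$ denote the completely mixed state. *Unitary families.* Let $X'$ be a Hilbert space of the same dimension as $X$, and let $\{|s\rangle\}_{s\in S}$ be the product basis of $X'^4:=(X')^{\otimes 4}$, so $|S|=|X|^4$. A family $\{V_a^{XX'^4}\}_{a\in[A]}$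 is called *admissible* if there are $N\in\mathbb N$, unitaries $U_1,\dots,U_N$ on $X$ forming a 1-design, i.e. $\frac1N\sum_{d=1}^N U_d\,\omega\,U_d^\dagger=(\mathrm{Tr}\,\omega)\,\mu^X$ for every matrix $\omega$ on $X$, and functions $h_a:S\to[N]$, $a\in[A]$, that are pairwise independent hash functions (for uniformly random $s\in S$ each $h_a(s)$ is uniform on $[N]$, and $h_a(s),h_{a'}(s)$ are independent whenever $a\ne a'$), such that $$V_a=\sum_{s\in S}U_{h_a(s)}^{X}\otimes|s\rangle\langle s|^{X'^4}\qquad(a\in[A]).$$ Admissible families $\{W_b^{YY'^4}\}_{b\in[B]}$ are defined in the same way. *Statement.* Let $\rho^{XYM}\neq0$ be a subnormalised density matrix, $0<\epsilon<1$, $A,B$ positive integers, and let $\{V_a^{XX'^4}\}_{a\in[A]}$, $\{W_b^{YY'^4}\}_{b\in[B]}$ be admissible families. Define the convex split state $$\sigma:=\frac1{AB}\sum_{a=1}^A\sum_{b=1}^B(V_a\otimes W_b\otimes 1^M)\,(\rho^{XYM}\otimes\mu^{X'^4Y'^4})\,(V_a\otimes W_b\otimes 1^M)^\dagger$$ and the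 fully decoupled state $\tau:=\mu^X\otimes\mu^Y\otimes\rho^M\otimes\mu^{X'^4Y'^4}$. Suppose $$\log A> D_2^\epsilon(\rho^{XM}\|\mu^X\otimes\rho^M)+\log\epsilon^{-2},\qquad \log B> D_2^\epsilon(\rho^{YM}\|\mu^Y\otimes\rho^M)+\log\epsilon^{-2},$$ $$\log A+\log B> D_2^\epsilon(\rho^{XYM}\|\mu^X\otimes\mu^Y\otimes\rho^M)+\log\epsilon^{-2}.$$ Then $$\|\sigma-\tau\|_1<8\epsilon\left(\mathrm{Tr}\,\rho+\sqrt{\mathrm{Tr}\,\rho}\right),$$ which is $16\epsilon\,(\mathrm{Tr}\,\rho)=16\epsilon$ if $\rho$ is normalised. If moreover the three inequalities remain true with $\log(\mathrm{Tr}\,\rho)^{-1}$ added to each right hand side (no further condition if $\mathrm{Tr}\,\rho=1$), then $$\|\sigma-\tau\|_1<16\epsilon\,(\mathrm{Tr}\,\rho).$$ -/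

import Mathlib

open scoped Kronecker

noncomputable section

namespace ConvexSplit

open scoped ComplexOrder

/-! Operators on the finite dimensional Hilbert space with orthonormal basis indexed by a finite
type `n` are matrices `Matrix n n ℂ`; a tensor product of Hilbert spaces has the product type as
its index type.  All logarithms are to base two. -/

variable {n x y m S K : Type*} [Fintype n] [DecidableEq n] [Fintype x] [DecidableEq x]
  [Fintype y] [DecidableEq y] [Fintype m] [DecidableEq m] [Fintype S] [DecidableEq S]

/-- Trace norm (Schatten 1-norm) `Tr ((M† M)^{1/2})`. -/
def traceNorm (M : Matrix n n ℂ) : ℝ :=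
  (cfc Real.sqrt (M.conjTranspose * M)).trace.re

/-- Schatten 2-norm `(Tr (M† M))^{1/2}`. -/
def schattenTwoNorm (M : Matrix n n ℂ) : ℝ :=
  Real.sqrt (M.conjTranspose * M).trace.re

/-- Real power `β ^ s` of a positive semidefinite matrix, through its eigendecomposition.  For
`s ≠ 0` Mathlib's `0 ^ s = 0`, so a negative power is the power of the Moore-Penrose
pseudoinverse. -/
def psdPow (β : Matrix n n ℂ) (s : ℝ) : Matrix n n ℂ :=
  cfc (fun t : ℝ => t ^ s) β

/-- Support of a Hermitian matrix: the span of its eigenvectors with nonzero eigenvalue, which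
is its range. -/
def support (M : Matrix n n ℂ) : Submodule ℂ (n → ℂ) :=
  LinearMap.range M.mulVecLin

/-- Subnormalised density matrix. -/
def IsSubnormalized (α : Matrix n n ℂ) : Prop :=
  α.PosSemidef ∧ α.trace.re ≤ 1

/-- Base two logarithm of a nonnegative real, with `log 0 = -∞`. -/
def log2 (r : ℝ) : EReal :=
  if r ≤ 0 then ⊥ else ((Real.logb 2 r : ℝ) : EReal)

open Classical in
/-- Rényi-2 divergence `D₂(α ‖ β) = 2 log ‖β^{-1/4} α β^{-1/4}‖₂` if `supp α ≤ supp β`, and `+∞`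
otherwise. -/
def renyiTwo (α β : Matrix n n ℂ) : EReal :=
  if support α ≤ support β then
    2 * log2 (schattenTwoNorm (psdPow β (-(1 / 4)) * α * psdPow β (-(1 / 4))))
  else ⊤

/-- Smooth Rényi-2 divergence `D₂^ε(α ‖ β)`: the minimum of `D₂(α' ‖ β)` over the subnormalised
density matrices `α'` with `‖α' - α‖₁ ≤ ε Tr α`. -/
def smoothRenyiTwo (ε : ℝ) (α β : Matrix n n ℂ) : EReal :=
  ⨅ α' ∈ {α' : Matrix n n ℂ | IsSubnormalized α' ∧ traceNorm (α' - α) ≤ ε * α.trace.re},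
    renyiTwo α' β

variable (n) in
/-- Completely mixed state. -/
def mixed : Matrix n n ℂ :=
  (Fintype.card n : ℂ)⁻¹ • (1 : Matrix n n ℂ)

/-- The marginal `ρ^{XM}` of `ρ^{XYM}`. -/
def marginalXM (ρ : Matrix (x × y × m) (x × y × m) ℂ) : Matrix (x × m) (x × m) ℂ :=
  Matrix.of fun i j => ∑ b : y, ρ (i.1, b, i.2) (j.1, b, j.2)

/-- The marginal `ρ^{YM}` of `ρ^{XYM}`. -/
def marginalYM (ρ : Matrix (x × y × m) (x × y × m) ℂ) : Matrix (y × m) (y × m) ℂ :=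
  Matrix.of fun i j => ∑ a : x, ρ (a, i) (a, j)

/-- The marginal `ρ^M` of `ρ^{XYM}`. -/
def marginalM (ρ : Matrix (x × y × m) (x × y × m) ℂ) : Matrix m m ℂ :=
  Matrix.of fun i j => ∑ a : x, ∑ b : y, ρ (a, b, i) (a, b, j)

/-- A 1-design of unitaries, indexed by `Fin N`: averaging the conjugations by its members is
the completely depolarising map. -/
def IsOneDesign {N : ℕ} (U : Fin N → Matrix x x ℂ) : Prop :=
  (∀ d, U d ∈ Matrix.unitaryGroup x ℂ) ∧
    ∀ ω : Matrix x x ℂ,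
      (N : ℂ)⁻¹ • ∑ d, U d * ω * (U d).conjTranspose = ω.trace • mixed x

/-- A family `h k : S → Fin N` of pairwise independent hash functions: for a uniformly random seed
`s : S` each value `h k s` is uniform, and two values `h k s`, `h k' s` with `k ≠ k'` are
independent. -/
def IsPairwiseIndependent {N : ℕ} (h : K → S → Fin N) : Prop :=
  (∀ k d, (Finset.univ.filter fun s => h k s = d).card * N = Fintype.card S) ∧
    ∀ k k', k ≠ k' → ∀ d d',
      (Finset.univ.filter fun s => h k s = d ∧ h k' s = d').card * N ^ 2 = Fintype.card S

/-- The unitaries `V_k = ∑_s U_{h_k(s)} ⊗ |s⟩⟨s|` on the tensor product of the system (basis `x`)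
and the seed register (basis `S`), for a 1-design `U` on the system and a family `h` of pairwise
independent hash functions from the seeds to the indices of the design. -/
def IsHashDesignFamily (V : K → Matrix (x × S) (x × S) ℂ) : Prop :=
  ∃ (N : ℕ) (U : Fin N → Matrix x x ℂ) (h : K → S → Fin N),
    IsOneDesign U ∧ IsPairwiseIndependent h ∧
      ∀ k, V k = ∑ s, U (h k s) ⊗ₖ Matrix.single s s (1 : ℂ)

/-- Index set of the fourfold tensor power of a Hilbert space with basis `x`. -/
abbrev Four (x : Type*) : Type _ := Fin 4 → x

/-- Rearrangement of the tensor factors `X Y M X'⁴ Y'⁴` into `X X'⁴ Y Y'⁴ M`. -/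
def rearrange (x y m : Type*) :
    (x × y × m) × (Four x × Four y) ≃ (x × Four x) × (y × Four y) × m where
  toFun p := ((p.1.1, p.2.1), (p.1.2.1, p.2.2), p.1.2.2)
  invFun q := ((q.1.1, q.2.1.1, q.2.2), (q.1.2, q.2.1.2))
  left_inv _ := rfl
  right_inv _ := rfl

/-- The operator `ω^{XYM} ⊗ μ^{X'⁴Y'⁴}`, on the factors in the order `X X'⁴ Y Y'⁴ M`. -/
def withCatalyst (ω : Matrix (x × y × m) (x × y × m) ℂ) :
    Matrix ((x × Four x) × (y × Four y) × m) ((x × Four x) × (y × Four y) × m) ℂ :=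
  Matrix.reindex (rearrange x y m) (rearrange x y m) (ω ⊗ₖ mixed (Four x × Four y))

/-- Convex split state
`(AB)⁻¹ ∑_{a,b} (V_a ⊗ W_b ⊗ 1) (ρ ⊗ μ) (V_a ⊗ W_b ⊗ 1)†`. -/
def convexSplitState {A B : ℕ} (V : Fin A → Matrix (x × Four x) (x × Four x) ℂ)
    (W : Fin B → Matrix (y × Four y) (y × Four y) ℂ)
    (ρ : Matrix (x × y × m) (x × y × m) ℂ) :
    Matrix ((x × Four x) × (y × Four y) × m) ((x × Four x) × (y × Four y) × m) ℂ :=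
  ((A : ℂ) * (B : ℂ))⁻¹ • ∑ a, ∑ b,
    (V a ⊗ₖ (W b ⊗ₖ (1 : Matrix m m ℂ))) * withCatalyst ρ *
      (V a ⊗ₖ (W b ⊗ₖ (1 : Matrix m m ℂ))).conjTranspose

/-- Fully decoupled state `μ^X ⊗ μ^Y ⊗ ρ^M ⊗ μ^{X'⁴Y'⁴}`. -/
def decoupledState (ρ : Matrix (x × y × m) (x × y × m) ℂ) :
    Matrix ((x × Four x) × (y × Four y) × m) ((x × Four x) × (y × Four y) × m) ℂ :=
  withCatalyst (mixed x ⊗ₖ (mixed y ⊗ₖ marginalM ρ))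

end ConvexSplit

end

open ConvexSplit

/-! Expanding the mixed catalyst in the seed basis makes both states block diagonal, so the trace
distance is at most the average over seed pairs (s,t) of the trace norm of one block. In that block
the average over a, b of the unitaries `U (h a s)` and `W (h' b t)` acts on ρ, and the decoupled
state is subtracted.

Let T_X and T_Y be the twirls over the two designs. Inside a block, ρ minus the decoupled state is
the sum of (1-T_X)(1-T_Y)ρ and of ρ^{XM} and ρ^{YM} minus their decoupled versions, each tensored
with a mixed state (`average_average_sub_eq`). Each piece is L applied to ρ or to a marginal, where
L is annihilated by the relevant twirls. Pairwise independence then makes the conjugates of L Z for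
distinct indices orthogonal on average over the seeds (`IsPairwiseIndependent.sum_inner_eq_zero`),
so averaging K of them shrinks the mean 2-norm by √K (`sum_norm_average_conjBy_le`).

To pass to the trace norm, write the smoothed operator as g Z g with g = β^{1/4}. Everything
commutes with this weighting, and weighted Cauchy-Schwarz (`traceNorm_conj_le`) costs √(Tr β). Since
L is linear and bounded, the three pieces are smoothed by unrelated operators, and no common
smoothing of ρ is needed (`sum_traceNorm_average_conjBy_lt`). The bounds 4, 2, 2 on the three maps L
add up to the constant 8. -/

namespace ConvexSplit

open scoped ComplexOrder
open Matrix

/-! ### Trace norm of Hermitian matrices -/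

section TraceNorm

variable {n k : Type*} [Fintype n] [DecidableEq n] [Fintype k] [DecidableEq k]

theorem traceNorm_eq_trace_cfc_abs {M : Matrix n n ℂ} (hM : M.IsHermitian) :
    traceNorm M = (cfc (fun t : ℝ => |t|) M).trace.re := by
  have hsa : IsSelfAdjoint M := hM
  have hc : ∀ f : ℝ → ℝ, ContinuousOn f (spectrum ℝ M) := fun f =>
    M.finite_real_spectrum.continuousOn f
  have hsq : M.conjTranspose * M = cfc (fun t : ℝ => t * t) M := by
    rw [cfc_mul (fun t : ℝ => t) (fun t : ℝ => t) M (hc _) (hc _), cfc_id' ℝ M, hM.eq]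
  unfold traceNorm
  rw [hsq, ← cfc_comp' Real.sqrt (fun t : ℝ => t * t) M
    (Real.continuous_sqrt.continuousOn) (hc _)]
  simp only [Real.sqrt_mul_self_eq_abs]

theorem exists_sign {M : Matrix n n ℂ} (hM : M.IsHermitian) :
    ∃ R : Matrix n n ℂ, R.IsHermitian ∧ R * R = 1 ∧ (R * M).trace.re = traceNorm M := by
  have hsa : IsSelfAdjoint M := hM
  have hc : ∀ f : ℝ → ℝ, ContinuousOn f (spectrum ℝ M) := fun f =>
    M.finite_real_spectrum.continuousOn f
  -- The sign of 0 is taken to be 1, so that R is an involution even when M is singular.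
  refine ⟨cfc (fun t : ℝ => if 0 ≤ t then (1 : ℝ) else -1) M, ?_, ?_, ?_⟩
  · exact cfc_predicate (R := ℝ) _ M
  · rw [← cfc_mul _ _ M (hc _) (hc _), ← cfc_one ℝ M]
    congr 1
    funext t
    split_ifs <;> simp
  · rw [traceNorm_eq_trace_cfc_abs hM]
    congr 2
    nth_rewrite 2 [← cfc_id' ℝ M]
    rw [← cfc_mul _ _ M (hc _) (hc _)]
    congr 1
    funext t
    split_ifs with h
    · simp [abs_of_nonneg h]
    · simp [abs_of_neg (not_le.1 h)]

/-- Jordan decomposition from the functional calculus. Together with `traceNorm_sub_le` it reduces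
bounds on the trace norm to traces of positive matrices. -/
theorem exists_posSemidef_sub {M : Matrix n n ℂ} (hM : M.IsHermitian) :
    ∃ P Q : Matrix n n ℂ, P.PosSemidef ∧ Q.PosSemidef ∧ M = P - Q ∧
      P.trace.re + Q.trace.re = traceNorm M := by
  have hsa : IsSelfAdjoint M := hM
  have hc : ∀ f : ℝ → ℝ, ContinuousOn f (spectrum ℝ M) := fun f =>
    M.finite_real_spectrum.continuousOn f
  open scoped MatrixOrder in
  refine ⟨cfc (fun t : ℝ => max t 0) M, cfc (fun t : ℝ => max (-t) 0) M,
    Matrix.nonneg_iff_posSemidef.1 (cfc_nonneg fun t _ => le_max_right _ _),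
    Matrix.nonneg_iff_posSemidef.1 (cfc_nonneg fun t _ => le_max_right _ _), ?_, ?_⟩
  · rw [← cfc_sub _ _ M (hc _) (hc _)]
    conv_lhs => rw [← cfc_id' ℝ M]
    congr 1
    funext t
    rcases le_total 0 t with h | h <;> simp [h]
  · rw [traceNorm_eq_trace_cfc_abs hM, ← Complex.add_re, ← Matrix.trace_add,
      ← cfc_add (a := M) _ _ (hc _) (hc _)]
    congr 3
    funext t
    rcases le_total 0 t with h | h <;> simp [h, abs_of_nonneg, abs_of_nonpos]

/-- The matrix (1-R)P(1-R)† is positive and (1-R)² = 2(1-R), so its trace 2 Tr P - 2 Tr RP is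
nonnegative. -/
theorem re_trace_mul_le_of_involutive {R P : Matrix n n ℂ} (hR : R.IsHermitian) (hRR : R * R = 1)
    (hP : P.PosSemidef) : (R * P).trace.re ≤ P.trace.re := by
  have h1 : ((1 - R) * P * (1 - R)ᴴ).PosSemidef := hP.mul_mul_conjTranspose_same _
  have h2 := h1.trace_nonneg
  have h3 : ((1 - R) * P * (1 - R)ᴴ).trace = 2 * P.trace - 2 * (R * P).trace := by
    rw [Matrix.trace_mul_comm, ← Matrix.mul_assoc, conjTranspose_sub, conjTranspose_one, hR.eq]
    have : (1 - R) * (1 - R) = (2 : ℂ) • (1 - R) := by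
      simp only [sub_mul, mul_sub, hRR, one_mul, mul_one, two_smul]; abel
    rw [this, smul_mul_assoc, sub_mul, one_mul, trace_smul, trace_sub, smul_eq_mul]; ring
  rw [h3, Complex.le_def] at h2
  have := h2.1
  simp at this
  linarith

/-- With R the sign of P - Q, the trace of R(P - Q) is bounded by testing P against the involution R
and Q against -R. -/
theorem traceNorm_sub_le {P Q : Matrix n n ℂ} (hP : P.PosSemidef) (hQ : Q.PosSemidef) :
    traceNorm (P - Q) ≤ P.trace.re + Q.trace.re := by
  obtain ⟨R, hR, hRR, h⟩ := exists_sign (hP.isHermitian.sub hQ.isHermitian)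
  have h1 := re_trace_mul_le_of_involutive hR hRR hP
  have h2 := re_trace_mul_le_of_involutive (R := -R) hR.neg (by simpa using hRR) hQ
  rw [← h, mul_sub, trace_sub, Complex.sub_re]
  simp only [neg_mul, trace_neg, Complex.neg_re] at h2
  linarith

theorem traceNorm_add_le {M M' : Matrix n n ℂ} (hM : M.IsHermitian) (hM' : M'.IsHermitian) :
    traceNorm (M + M') ≤ traceNorm M + traceNorm M' := by
  obtain ⟨P, Q, hP, hQ, rfl, h⟩ := exists_posSemidef_sub hM
  obtain ⟨P', Q', hP', hQ', rfl, h'⟩ := exists_posSemidef_sub hM'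
  rw [← h, ← h', sub_add_sub_comm]
  refine (traceNorm_sub_le (hP.add hP') (hQ.add hQ')).trans_eq ?_
  simp only [trace_add, Complex.add_re]; ring

theorem traceNorm_neg (M : Matrix n n ℂ) : traceNorm (-M) = traceNorm M := by
  simp [traceNorm]

theorem traceNorm_zero : traceNorm (0 : Matrix n n ℂ) = 0 := by
  rw [traceNorm_eq_trace_cfc_abs (isHermitian_zero)]
  simp

theorem traceNorm_sum_le {ι : Type*} (s : Finset ι) (M : ι → Matrix n n ℂ)
    (hM : ∀ i, (M i).IsHermitian) : traceNorm (∑ i ∈ s, M i) ≤ ∑ i ∈ s, traceNorm (M i) := by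
  classical
  induction s using Finset.induction_on with
  | empty => simp [traceNorm_zero]
  | insert a s ha ih =>
    rw [Finset.sum_insert ha, Finset.sum_insert ha]
    refine (traceNorm_add_le (hM a) ?_).trans (add_le_add_right ih _)
    exact isSelfAdjoint_sum s fun i _ => hM i

/-- A positive map which multiplies traces by `c` multiplies trace norms by at most `c`. -/
theorem traceNorm_map_le (φ : Matrix n n ℂ →ₗ[ℂ] Matrix k k ℂ) (c : ℝ)
    (hφ : ∀ P, P.PosSemidef → (φ P).PosSemidef) (htr : ∀ P, (φ P).trace = c * P.trace)
    {M : Matrix n n ℂ} (hM : M.IsHermitian) : traceNorm (φ M) ≤ c * traceNorm M := by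
  obtain ⟨P, Q, hP, hQ, rfl, h⟩ := exists_posSemidef_sub hM
  rw [← h, map_sub]
  refine (traceNorm_sub_le (hφ P hP) (hφ Q hQ)).trans_eq ?_
  simp [htr, mul_add]

theorem traceNorm_smul_le {c : ℝ} (hc : 0 ≤ c) {M : Matrix n n ℂ} (hM : M.IsHermitian) :
    traceNorm ((c : ℂ) • M) ≤ c * traceNorm M := by
  have h0 : (0 : ℂ) ≤ c := by exact_mod_cast hc
  refine traceNorm_map_le ((c : ℂ) • (LinearMap.id : Matrix n n ℂ →ₗ[ℂ] Matrix n n ℂ)) c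
    (fun P hP => ?_) (fun P => ?_) hM
  · rw [LinearMap.smul_apply, LinearMap.id_apply]
    exact hP.smul h0
  · rw [LinearMap.smul_apply, LinearMap.id_apply, trace_smul, smul_eq_mul]

end TraceNorm

/-! ### Hilbert-Schmidt norm and weighted Cauchy-Schwarz -/

section Frobenius

variable {n : Type*} [Fintype n] [DecidableEq n]

/-- A matrix as a vector of the Euclidean space with the Hilbert-Schmidt inner product. -/
def vec : Matrix n n ℂ →ₗ[ℂ] EuclideanSpace ℂ (n × n) where
  toFun M := WithLp.toLp 2 fun p => M p.1 p.2
  map_add' _ _ := rfl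
  map_smul' _ _ := rfl

theorem inner_vec (M M' : Matrix n n ℂ) : inner ℂ (vec M) (vec M') = (Mᴴ * M').trace := by
  simp only [PiLp.inner_apply, RCLike.inner_apply, Matrix.trace, Matrix.diag_apply,
    Matrix.mul_apply, conjTranspose_apply, Fintype.sum_prod_type]
  rw [Finset.sum_comm]
  exact Finset.sum_congr rfl fun i _ => Finset.sum_congr rfl fun j _ => mul_comm _ _

theorem norm_vec (M : Matrix n n ℂ) : ‖vec M‖ = schattenTwoNorm M := by
  rw [schattenTwoNorm, ← inner_vec, @norm_eq_sqrt_re_inner ℂ]; rfl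

theorem norm_vec_conj {G : Matrix n n ℂ} (hG : Gᴴ * G = 1) (Z : Matrix n n ℂ) :
    ‖vec (G * Z * Gᴴ)‖ = ‖vec Z‖ := by
  rw [norm_vec, norm_vec, schattenTwoNorm, schattenTwoNorm]
  congr 2
  rw [conjTranspose_mul, conjTranspose_mul, conjTranspose_conjTranspose]
  calc (G * (Zᴴ * Gᴴ) * (G * Z * Gᴴ)).trace
      = (G * (Zᴴ * ((Gᴴ * G) * Z) * Gᴴ)).trace := by simp only [Matrix.mul_assoc]
    _ = (Zᴴ * Z).trace := by
      rw [hG, one_mul, Matrix.trace_mul_comm, Matrix.mul_assoc, hG, mul_one]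

/-- Weighted Cauchy-Schwarz inequality for the trace norm. -/
theorem traceNorm_conj_le {g Y : Matrix n n ℂ} (hg : g.IsHermitian) (hY : Y.IsHermitian) :
    traceNorm (g * Y * g) ≤ Real.sqrt (g * g * (g * g)).trace.re * ‖vec Y‖ := by
  have hM : (g * Y * g).IsHermitian := by
    have := isHermitian_mul_mul_conjTranspose g hY
    rwa [hg.eq] at this
  obtain ⟨R, hR, hRR, h⟩ := exists_sign hM
  -- Cyclicity moves the weights from Y to the sign matrix R, after which Cauchy-Schwarz separates
  -- Y.
  have e1 : (R * (g * Y * g)).trace = inner ℂ (vec (g * R * g)) (vec Y) := by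
    rw [inner_vec, conjTranspose_mul, conjTranspose_mul, hg.eq, hR.eq]
    rw [← Matrix.mul_assoc, Matrix.trace_mul_comm]; simp only [Matrix.mul_assoc]
  -- The left side is the inner product of R g² with g² R, and both have squared norm Tr g⁴ because
  -- R² = 1.
  have e2 : ‖vec (g * R * g)‖ ^ 2 ≤ (g * g * (g * g)).trace.re := by
    have h1 : ‖vec (g * R * g)‖ ^ 2 = (inner ℂ (vec (R * (g * g))) (vec ((g * g) * R))).re := by
      rw [@norm_sq_eq_re_inner ℂ, inner_vec, inner_vec]
      simp only [conjTranspose_mul, hg.eq, hR.eq, RCLike.re_to_complex]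
      congr 1
      calc (g * (R * g) * (g * R * g)).trace = (g * (R * g * (g * R * g))).trace := by
            rw [Matrix.mul_assoc]
        _ = (R * (g * (g * R * g) * g)).trace := by
            rw [Matrix.trace_mul_comm]; simp only [Matrix.mul_assoc]
        _ = (g * g * R * (g * g * R)).trace := by
            rw [Matrix.trace_mul_comm]; simp only [Matrix.mul_assoc]
    have h2 : ‖vec (R * (g * g))‖ = Real.sqrt (g * g * (g * g)).trace.re := by
      rw [norm_vec, schattenTwoNorm]
      simp only [conjTranspose_mul, hg.eq, hR.eq]
      congr 3
      rw [Matrix.mul_assoc, ← Matrix.mul_assoc R, hRR, one_mul]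
    have h3 : ‖vec (g * g * R)‖ = Real.sqrt (g * g * (g * g)).trace.re := by
      rw [norm_vec, schattenTwoNorm]
      simp only [conjTranspose_mul, hg.eq, hR.eq]
      congr 2
      rw [Matrix.trace_mul_comm, Matrix.mul_assoc, ← Matrix.mul_assoc R, hRR, one_mul]
    rw [h1]
    refine (Complex.re_le_norm _).trans ((norm_inner_le_norm _ _).trans ?_)
    rw [h2, h3, Real.mul_self_sqrt]
    have := (posSemidef_conjTranspose_mul_self (g * g)).trace_nonneg
    rw [conjTranspose_mul, hg.eq] at this
    exact (Complex.le_def.1 this).1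
  rw [← h, e1]
  refine (Complex.re_le_norm _).trans ((norm_inner_le_norm _ _).trans ?_)
  gcongr
  exact Real.le_sqrt_of_sq_le e2

end Frobenius

/-! ### Averages of conjugations and their norm bounds -/

section Superoperators

variable {n ι : Type*} [Fintype n] [DecidableEq n] [Fintype ι]

/-- Conjugation `Z ↦ G Z G†`. -/
def conjBy (G : Matrix n n ℂ) : Matrix n n ℂ →ₗ[ℂ] Matrix n n ℂ :=
  LinearMap.mulLeftRight ℂ (G, Gᴴ)

@[simp] theorem conjBy_apply (G Z : Matrix n n ℂ) : conjBy G Z = G * Z * Gᴴ := by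
  simp [conjBy]

/-- Uniform average of a finite family of linear maps. -/
noncomputable def average (L : ι → Matrix n n ℂ →ₗ[ℂ] Matrix n n ℂ) : Matrix n n ℂ →ₗ[ℂ] Matrix n n ℂ :=
  (Fintype.card ι : ℂ)⁻¹ • ∑ i, L i

theorem average_apply (L : ι → Matrix n n ℂ →ₗ[ℂ] Matrix n n ℂ) (Z : Matrix n n ℂ) :
    average L Z = (Fintype.card ι : ℂ)⁻¹ • ∑ i, L i Z := by
  simp [average]

/-- `L` preserves hermiticity, is bounded by `c` in the trace norm and in the Hilbert-Schmidt norm,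
and commutes with `Z ↦ g Z g`. -/
structure IsBoundedMap (g : Matrix n n ℂ) (c : ℝ) (L : Matrix n n ℂ →ₗ[ℂ] Matrix n n ℂ) : Prop where
  nonneg : 0 ≤ c
  isHermitian : ∀ Z, Z.IsHermitian → (L Z).IsHermitian
  traceNorm_le : ∀ Z, Z.IsHermitian → traceNorm (L Z) ≤ c * traceNorm Z
  norm_le : ∀ Z, ‖vec (L Z)‖ ≤ c * ‖vec Z‖
  weight : ∀ Z, L (g * Z * g) = g * L Z * g

namespace IsBoundedMap

variable {g : Matrix n n ℂ} {c c' : ℝ} {L L' : Matrix n n ℂ →ₗ[ℂ] Matrix n n ℂ}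

theorem id : IsBoundedMap g 1 (LinearMap.id : Matrix n n ℂ →ₗ[ℂ] Matrix n n ℂ) :=
  ⟨zero_le_one, fun _ h => h, fun _ _ => by simp, fun _ => by simp, fun _ => rfl⟩

theorem sub (h : IsBoundedMap g c L) (h' : IsBoundedMap g c' L') :
    IsBoundedMap g (c + c') (L - L') where
  nonneg := add_nonneg h.nonneg h'.nonneg
  isHermitian Z hZ := (h.isHermitian Z hZ).sub (h'.isHermitian Z hZ)
  traceNorm_le Z hZ := by
    rw [LinearMap.sub_apply, sub_eq_add_neg, add_mul]
    refine (traceNorm_add_le (h.isHermitian Z hZ) (h'.isHermitian Z hZ).neg).trans ?_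
    rw [traceNorm_neg]
    exact add_le_add (h.traceNorm_le Z hZ) (h'.traceNorm_le Z hZ)
  norm_le Z := by
    rw [LinearMap.sub_apply, map_sub, add_mul]
    exact (norm_sub_le _ _).trans (add_le_add (h.norm_le Z) (h'.norm_le Z))
  weight Z := by
    simp only [LinearMap.sub_apply, h.weight, h'.weight, mul_sub, sub_mul]

theorem comp (h : IsBoundedMap g c L) (h' : IsBoundedMap g c' L') :
    IsBoundedMap g (c * c') (L ∘ₗ L') where
  nonneg := mul_nonneg h.nonneg h'.nonneg
  isHermitian Z hZ := h.isHermitian _ (h'.isHermitian Z hZ)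
  traceNorm_le Z hZ := by
    rw [mul_assoc]
    exact (h.traceNorm_le _ (h'.isHermitian Z hZ)).trans
      (mul_le_mul_of_nonneg_left (h'.traceNorm_le Z hZ) h.nonneg)
  norm_le Z := by
    rw [mul_assoc]
    exact (h.norm_le _).trans (mul_le_mul_of_nonneg_left (h'.norm_le Z) h.nonneg)
  weight Z := by simp only [LinearMap.comp_apply, h.weight, h'.weight]

theorem conjBy {G : Matrix n n ℂ} (hG : G ∈ unitaryGroup n ℂ) (hg : g.IsHermitian)
    (hc : Commute G g) : IsBoundedMap g 1 (conjBy G) where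
  nonneg := zero_le_one
  isHermitian Z hZ := by
    rw [conjBy_apply]; exact isHermitian_mul_mul_conjTranspose G hZ
  traceNorm_le Z hZ := by
    have := traceNorm_map_le (ConvexSplit.conjBy G) 1
      (fun P hP => by rw [conjBy_apply]; exact hP.mul_mul_conjTranspose_same G)
      (fun P => by
        rw [conjBy_apply, Matrix.trace_mul_comm, ← Matrix.mul_assoc,
          ← star_eq_conjTranspose, mem_unitaryGroup_iff'.1 hG]; simp) hZ
    simpa using this
  norm_le Z := by
    rw [conjBy_apply, norm_vec_conj (mem_unitaryGroup_iff'.1 hG), one_mul]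
  weight Z := by
    have h2 : g * Gᴴ = Gᴴ * g := by
      have := congrArg conjTranspose hc.eq
      simpa [hg.eq] using this
    rw [conjBy_apply, conjBy_apply]
    calc G * (g * Z * g) * Gᴴ = (G * g) * Z * (g * Gᴴ) := by simp only [Matrix.mul_assoc]
      _ = g * (G * Z * Gᴴ) * g := by rw [h2, hc.eq]; simp only [Matrix.mul_assoc]

theorem average {L : ι → Matrix n n ℂ →ₗ[ℂ] Matrix n n ℂ} (h : ∀ i, IsBoundedMap g 1 (L i)) :
    IsBoundedMap g 1 (average L) where
  nonneg := zero_le_one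
  isHermitian Z hZ := by
    rw [average_apply]
    have h1 : (∑ i, L i Z).IsHermitian :=
      isSelfAdjoint_sum _ fun i _ => (h i).isHermitian Z hZ
    have h2 : IsSelfAdjoint (Fintype.card ι : ℂ)⁻¹ := by simp [IsSelfAdjoint]
    exact h2.smul h1
  traceNorm_le Z hZ := by
    have h1 : (∑ i, L i Z).IsHermitian :=
      isSelfAdjoint_sum _ fun i _ => (h i).isHermitian Z hZ
    have h0 : 0 ≤ traceNorm Z := by
      obtain ⟨P, Q, hP, hQ, -, h⟩ := exists_posSemidef_sub hZ
      rw [← h]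
      exact add_nonneg (Complex.le_def.1 hP.trace_nonneg).1 (Complex.le_def.1 hQ.trace_nonneg).1
    have h2 := traceNorm_smul_le (c := (Fintype.card ι : ℝ)⁻¹) (by positivity) h1
    rw [average_apply]
    push_cast at h2
    refine h2.trans ?_
    calc (Fintype.card ι : ℝ)⁻¹ * traceNorm (∑ i, L i Z)
        ≤ (Fintype.card ι : ℝ)⁻¹ * ∑ _i : ι, 1 * traceNorm Z := by
          gcongr
          exact (traceNorm_sum_le _ _ fun i => (h i).isHermitian Z hZ).trans
            (Finset.sum_le_sum fun i _ => (h i).traceNorm_le Z hZ)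
      _ = ((Fintype.card ι : ℝ)⁻¹ * Fintype.card ι) * traceNorm Z := by simp [mul_assoc]
      -- An inequality rather than an equality, which also covers an empty index type, where the
      -- average is 0.
      _ ≤ 1 * traceNorm Z := mul_le_mul_of_nonneg_right inv_mul_le_one h0
  norm_le Z := by
    rw [average_apply, map_smul, norm_smul, map_sum, norm_inv, Complex.norm_natCast]
    calc (Fintype.card ι : ℝ)⁻¹ * ‖∑ i, vec (L i Z)‖
        ≤ (Fintype.card ι : ℝ)⁻¹ * ∑ _i : ι, 1 * ‖vec Z‖ := by
          gcongr
          exact (norm_sum_le _ _).trans (Finset.sum_le_sum fun i _ => (h i).norm_le Z)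
      _ = ((Fintype.card ι : ℝ)⁻¹ * Fintype.card ι) * ‖vec Z‖ := by simp [mul_assoc]
      _ ≤ 1 * ‖vec Z‖ := mul_le_mul_of_nonneg_right inv_mul_le_one (norm_nonneg _)
  weight Z := by
    simp only [average_apply, (h _).weight, mul_smul_comm, smul_mul_assoc, Finset.mul_sum,
      Finset.sum_mul]

end IsBoundedMap

end Superoperators

/-! ### Second moment method -/

section SecondMoment

variable {n K R : Type*} [Fintype n] [DecidableEq n] [Fintype K] [DecidableEq K] [Fintype R]

/-- Pythagoras on average: the cross terms vanish only after summation over r, not for each r. -/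
theorem sum_norm_sq_of_pairwise_orthogonal {E : Type*} [NormedAddCommGroup E]
    [InnerProductSpace ℂ E] (v : K → R → E) (b : ℝ)
    (horth : ∀ k k', k ≠ k' → ∑ r, inner ℂ (v k r) (v k' r) = 0) (hb : ∀ k r, ‖v k r‖ = b) :
    ∑ r, ‖∑ k, v k r‖ ^ 2 = Fintype.card R * Fintype.card K * b ^ 2 := by
  have h : (∑ r, inner ℂ (∑ k, v k r) (∑ k, v k r) : ℂ)
      = Fintype.card R * Fintype.card K * (b : ℂ) ^ 2 := by
    simp only [sum_inner, inner_sum]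
    rw [Finset.sum_comm]
    calc ∑ k', ∑ r, ∑ k, inner ℂ (v k r) (v k' r)
        = ∑ k' : K, ∑ k : K, if k = k' then (Fintype.card R : ℂ) * (b : ℂ) ^ 2 else 0 := by
          refine Finset.sum_congr rfl fun k' _ => ?_
          rw [Finset.sum_comm]
          refine Finset.sum_congr rfl fun k _ => ?_
          split_ifs with hk
          · subst hk
            simp [inner_self_eq_norm_sq_to_K, hb]
          · exact horth k k' hk
      _ = _ := by simp; ring
  have h2 : ((∑ r, ‖∑ k, v k r‖ ^ 2 : ℝ) : ℂ)
      = ((Fintype.card R * Fintype.card K * b ^ 2 : ℝ) : ℂ) := by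
    push_cast
    rw [← h]
    simp [inner_self_eq_norm_sq_to_K]
  exact_mod_cast h2

/-- Unitary conjugation keeps the 2-norm, so the second moment of the average is ‖z‖²/|K|.
Cauchy-Schwarz over r turns this into a bound on the first moment. -/
theorem sum_norm_average_conjBy_le (G : K → R → Matrix n n ℂ)
    (hG : ∀ k r, G k r ∈ unitaryGroup n ℂ) (z : Matrix n n ℂ)
    (horth : ∀ k k', k ≠ k' →
      ∑ r, inner ℂ (vec (conjBy (G k r) z)) (vec (conjBy (G k' r) z)) = 0) :
    ∑ r, ‖vec (average (fun k => conjBy (G k r)) z)‖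
      ≤ Fintype.card R * (‖vec z‖ / Real.sqrt (Fintype.card K)) := by
  have h1 := sum_norm_sq_of_pairwise_orthogonal (fun k r => vec (conjBy (G k r) z)) ‖vec z‖ horth
    fun k r => by rw [conjBy_apply, norm_vec_conj (mem_unitaryGroup_iff'.1 (hG k r))]
  have h2 : ∑ r, ‖vec (average (fun k => conjBy (G k r)) z)‖ ^ 2
      = Fintype.card R * (‖vec z‖ / Real.sqrt (Fintype.card K)) ^ 2 := by
    simp only [average_apply, map_smul, map_sum, norm_smul, mul_pow, ← Finset.mul_sum, h1,
      norm_inv, Complex.norm_natCast]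
    rw [div_pow, Real.sq_sqrt (Nat.cast_nonneg _)]
    rcases eq_or_ne (Fintype.card K : ℝ) 0 with h0 | h0
    · simp [h0]
    · field_simp
  refine le_of_sq_le_sq ?_ (by positivity)
  refine (sq_sum_le_card_mul_sum_sq (s := Finset.univ)).trans_eq ?_
  rw [h2, Finset.card_univ]; ring

/-- Decoupling bound: replacing `ρ` by a nearby operator `g Z g` of small Hilbert-Schmidt norm. -/
theorem sum_traceNorm_average_conjBy_le {g : Matrix n n ℂ} (hg : g.IsHermitian) {c δ : ℝ}
    {L : Matrix n n ℂ →ₗ[ℂ] Matrix n n ℂ} (hL : IsBoundedMap g c L) (G : K → R → Matrix n n ℂ)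
    (hG : ∀ k r, G k r ∈ unitaryGroup n ℂ) (hGg : ∀ k r, Commute (G k r) g)
    {ρ Z : Matrix n n ℂ} (hρ : ρ.IsHermitian) (hZ : Z.IsHermitian)
    (hδ : traceNorm (g * Z * g - ρ) ≤ δ)
    (horth : ∀ k k', k ≠ k' →
      ∑ r, inner ℂ (vec (conjBy (G k r) (L Z))) (vec (conjBy (G k' r) (L Z))) = 0) :
    ∑ r, traceNorm (average (fun k => conjBy (G k r)) (L ρ))
      ≤ Fintype.card R * (c * δ + Real.sqrt (g * g * (g * g)).trace.re
          * (c * ‖vec Z‖ / Real.sqrt (Fintype.card K))) := by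
  have hA : ∀ r, IsBoundedMap g 1 (average fun k => conjBy (G k r)) := fun r =>
    IsBoundedMap.average fun k => IsBoundedMap.conjBy (hG k r) hg (hGg k r)
  have hgZ : (g * Z * g).IsHermitian := by
    have := isHermitian_mul_mul_conjTranspose g hZ
    rwa [hg.eq] at this
  have hD : (ρ - g * Z * g).IsHermitian := hρ.sub hgZ
  have h1 : ∀ r, traceNorm (average (fun k => conjBy (G k r)) (L ρ)) ≤
      c * δ + Real.sqrt (g * g * (g * g)).trace.re *
        ‖vec (average (fun k => conjBy (G k r)) (L Z))‖ := fun r => by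
    -- The smoothing error is estimated in trace norm, where all maps are bounded. The main part
    -- keeps its weights g outside, ready for `traceNorm_conj_le`.
    have e : average (fun k => conjBy (G k r)) (L ρ)
        = average (fun k => conjBy (G k r)) (L (ρ - g * Z * g))
          + g * average (fun k => conjBy (G k r)) (L Z) * g := by
      rw [← (hA r).weight, ← hL.weight, ← map_add, ← map_add, sub_add_cancel]
    have hLZ := (hA r).isHermitian _ (hL.isHermitian _ hZ)
    have hLD := hL.isHermitian _ hD
    rw [e]
    refine (traceNorm_add_le ((hA r).isHermitian _ hLD) ?_).trans
      (add_le_add ?_ (traceNorm_conj_le hg hLZ))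
    · have := isHermitian_mul_mul_conjTranspose g hLZ
      rwa [hg.eq] at this
    · refine ((hA r).traceNorm_le _ hLD).trans ?_
      rw [one_mul]
      refine (hL.traceNorm_le _ hD).trans (mul_le_mul_of_nonneg_left ?_ hL.nonneg)
      rwa [← traceNorm_neg, neg_sub]
  refine (Finset.sum_le_sum fun r _ => h1 r).trans ?_
  rw [Finset.sum_add_distrib, Finset.sum_const, Finset.card_univ, nsmul_eq_mul, ← Finset.mul_sum,
    mul_add]
  refine add_le_add le_rfl ?_
  rw [mul_left_comm]
  refine mul_le_mul_of_nonneg_left ?_ (Real.sqrt_nonneg _)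
  refine (sum_norm_average_conjBy_le G hG _ horth).trans ?_
  gcongr
  exact hL.norm_le Z

end SecondMoment

/-! ### Pairwise independent hash functions -/

section PairwiseIndependence

variable {K S : Type*} [Fintype S]

/-- Every pair (d,d') is hit by the same number |S|/N² of seeds, so the sum is proportional to the
inner product of ∑ v and ∑ v'. It is enough that one of these vanishes. -/
theorem IsPairwiseIndependent.sum_inner_eq_zero {N : ℕ} {h : K → S → Fin N}
    (hh : IsPairwiseIndependent h) {k k' : K} (hk : k ≠ k') {E : Type*} [NormedAddCommGroup E]
    [InnerProductSpace ℂ E] (v v' : Fin N → E) (hv : ∑ d, v d = 0) :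
    ∑ s, inner ℂ (v (h k s)) (v' (h k' s)) = 0 := by
  have hN : (N : ℂ) ^ 2 ≠ 0 ∨ N = 0 := by
    rcases Nat.eq_zero_or_pos N with h0 | h0
    · exact Or.inr h0
    · exact Or.inl (pow_ne_zero _ (Nat.cast_ne_zero.2 h0.ne'))
  rcases hN with hN | rfl
  · refine (mul_eq_zero.1 (?_ : _ * (N : ℂ) ^ 2 = 0)).resolve_right hN
    have h1 : ∑ s, inner ℂ (v (h k s)) (v' (h k' s))
        = ∑ d, ∑ d', ((Finset.univ.filter fun s => h k s = d ∧ h k' s = d').card : ℂ)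
          * inner ℂ (v d) (v' d') := by
      simp only [Finset.card_filter, Nat.cast_sum, Finset.sum_mul]
      rw [Finset.sum_congr rfl fun d _ => Finset.sum_comm, Finset.sum_comm]
      refine Finset.sum_congr rfl fun s _ => ?_
      rw [Finset.sum_eq_single (h k s), Finset.sum_eq_single (h k' s)]
      · simp
      · intro d' _ hd'; simp [hd'.symm]
      · simp
      · intro d _ hd; simp [hd.symm]
      · simp
    have h2 : ∀ d d', ((Finset.univ.filter fun s => h k s = d ∧ h k' s = d').card : ℂ)
        * (N : ℂ) ^ 2 = Fintype.card S := fun d d' => by exact_mod_cast hh.2 k k' hk d d'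
    rw [h1]
    simp only [Finset.sum_mul]
    calc _ = ∑ d, ∑ d', (Fintype.card S : ℂ) * inner ℂ (v d) (v' d') := by
          refine Finset.sum_congr rfl fun d _ => Finset.sum_congr rfl fun d' _ => ?_
          rw [← h2 d d']; ring
      _ = 0 := by
          rw [Finset.sum_comm]
          simp only [← Finset.mul_sum, ← sum_inner, hv, inner_zero_left, mul_zero,
            Finset.sum_const_zero]
  · exact Finset.sum_eq_zero fun s _ => (h k s).elim0

end PairwiseIndependence

/-! ### Powers of β and the smooth Rényi-2 divergence -/

section Weights

variable {n : Type*} [Fintype n] [DecidableEq n]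

theorem psdPow_isHermitian (β : Matrix n n ℂ) (s : ℝ) : (psdPow β s).IsHermitian :=
  cfc_predicate (R := ℝ) _ β

theorem commute_psdPow {G β : Matrix n n ℂ} (hβ : β.IsHermitian) (h : Commute G β) (s : ℝ) :
    Commute G (psdPow β s) :=
  (IsSelfAdjoint.commute_cfc (show IsSelfAdjoint β from hβ) h.symm _).symm

theorem psdPow_quarter_pow {β : Matrix n n ℂ} (hβ : β.PosSemidef) :
    psdPow β (1 / 4) * psdPow β (1 / 4) * (psdPow β (1 / 4) * psdPow β (1 / 4)) = β := by
  have hsa : IsSelfAdjoint β := hβ.1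
  have hc : ∀ f : ℝ → ℝ, ContinuousOn f (spectrum ℝ β) := fun f =>
    β.finite_real_spectrum.continuousOn f
  unfold psdPow
  rw [← cfc_mul _ _ β (hc _) (hc _), ← cfc_mul _ _ β (hc _) (hc _)]
  conv_rhs => rw [← cfc_id' ℝ β]
  refine cfc_congr fun t ht => ?_
  have ht0 : 0 ≤ t := by
    open scoped MatrixOrder in
    exact spectrum_nonneg_of_nonneg (Matrix.nonneg_iff_posSemidef.2 hβ) ht
  have : (t ^ (1 / 4 : ℝ)) ^ (4 : ℕ) = t := by
    rw [← Real.rpow_natCast, ← Real.rpow_mul ht0]; norm_num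
  linear_combination this

/-- The product β^{1/4} β^{-1/4} fixes the range of β, hence the columns of α. This is where the
support condition in the divergence is needed. -/
theorem psdPow_quarter_conj {α β : Matrix n n ℂ} (hα : α.IsHermitian) (hβ : β.PosSemidef)
    (h : support α ≤ support β) :
    psdPow β (1 / 4) * (psdPow β (-(1 / 4)) * α * psdPow β (-(1 / 4))) * psdPow β (1 / 4) = α := by
  have hsa : IsSelfAdjoint β := hβ.1
  have hc : ∀ f : ℝ → ℝ, ContinuousOn f (spectrum ℝ β) := fun f =>
    β.finite_real_spectrum.continuousOn f
  have h1 : psdPow β (1 / 4) * psdPow β (-(1 / 4)) * β = β := by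
    unfold psdPow
    nth_rewrite 3 [← cfc_id' ℝ β]
    rw [← cfc_mul _ _ β (hc _) (hc _), ← cfc_mul _ _ β (hc _) (hc _)]
    conv_rhs => rw [← cfc_id' ℝ β]
    refine cfc_congr fun t ht => ?_
    have ht0 : 0 ≤ t := by
      open scoped MatrixOrder in
      exact spectrum_nonneg_of_nonneg (Matrix.nonneg_iff_posSemidef.2 hβ) ht
    rcases ht0.eq_or_lt with rfl | ht1
    · simp
    · simp [← Real.rpow_add ht1]
  have h2 : psdPow β (1 / 4) * psdPow β (-(1 / 4)) * α = α := by
    refine Matrix.ext_of_mulVec_single fun i => ?_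
    obtain ⟨w, hw⟩ := h ⟨Pi.single i 1, rfl⟩
    simp only [mulVecLin_apply] at hw
    rw [← mulVec_mulVec, ← hw, mulVec_mulVec, h1]
  have h3 : α * psdPow β (-(1 / 4)) * psdPow β (1 / 4) = α := by
    have := congrArg conjTranspose h2
    simpa only [conjTranspose_mul, hα.eq, (psdPow_isHermitian β _).eq, ← Matrix.mul_assoc]
      using this
  calc _ = (psdPow β (1 / 4) * psdPow β (-(1 / 4)) * α) * psdPow β (-(1 / 4)) * psdPow β (1 / 4) :=
        by simp only [Matrix.mul_assoc]
    _ = α := by rw [h2, h3]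

theorem log2_of_pos {r : ℝ} (hr : 0 < r) : log2 r = ((Real.logb 2 r : ℝ) : EReal) := by
  simp [log2, not_le.2 hr]

theorem log2_mul {r s : ℝ} (hr : 0 < r) (hs : 0 < s) : log2 (r * s) = log2 r + log2 s := by
  rw [log2_of_pos hr, log2_of_pos hs, log2_of_pos (mul_pos hr hs),
    Real.logb_mul hr.ne' hs.ne', EReal.coe_add]

/-- The strict inequality puts some candidate below the bound, so attainment of the infimum plays no
role. The parameter c stays free: it becomes ε² for the first bound of the theorem and ε² Tr ρ for
the second. -/
theorem exists_of_smoothRenyiTwo_add_lt {ε c k : ℝ} {α β : Matrix n n ℂ} (hc : 0 < c) (hk : 0 < k)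
    (h : smoothRenyiTwo ε α β + log2 c⁻¹ < log2 k) :
    ∃ α' : Matrix n n ℂ, α'.PosSemidef ∧ traceNorm (α' - α) ≤ ε * α.trace.re ∧
      support α' ≤ support β ∧
      schattenTwoNorm (psdPow β (-(1 / 4)) * α' * psdPow β (-(1 / 4))) < Real.sqrt c * Real.sqrt k
    := by
  rw [log2_of_pos (inv_pos.2 hc), log2_of_pos hk,
    ← EReal.lt_sub_iff_add_lt (by simp) (by simp), smoothRenyiTwo] at h
  simp only [iInf_lt_iff] at h
  obtain ⟨α', ⟨⟨hα', -⟩, hd⟩, h⟩ := h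
  unfold renyiTwo at h
  split_ifs at h with hs
  · refine ⟨α', hα', hd, hs, ?_⟩
    set r := schattenTwoNorm (psdPow β (-(1 / 4)) * α' * psdPow β (-(1 / 4)))
    rcases le_or_gt r 0 with hr | hr
    -- Here `log2 r` is `⊥` and carries no information, but the claim is trivial.
    · exact hr.trans_lt (mul_pos (Real.sqrt_pos.2 hc) (Real.sqrt_pos.2 hk))
    · rw [log2_of_pos hr] at h
      rw [show (2 : EReal) = ((2 : ℝ) : EReal) from rfl, ← EReal.coe_mul] at h
      have h' : 2 * Real.logb 2 r < Real.logb 2 k - Real.logb 2 c⁻¹ := by exact_mod_cast h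
      rw [Real.logb_inv, sub_neg_eq_add, ← Real.logb_mul hk.ne' hc.ne'] at h'
      have h2 : Real.logb 2 (r ^ 2) < Real.logb 2 (k * c) := by
        rw [Real.logb_pow]; exact_mod_cast h'
      have h3 := (Real.logb_lt_logb_iff one_lt_two (by positivity) (by positivity)).1 h2
      rw [← Real.sqrt_mul hc.le, mul_comm c k]
      exact Real.lt_sqrt_of_sq_lt h3
  · simp at h

end Weights

/-! ### One-shot decoupling bound -/

section SmoothedBound

variable {n K R : Type*} [Fintype n] [DecidableEq n] [Fintype K] [DecidableEq K] [Nonempty K]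
  [Fintype R] [Nonempty R]

/-- Decoupling bound in terms of the smooth Rényi-2 divergence. -/
theorem sum_traceNorm_average_conjBy_lt {ρ β : Matrix n n ℂ} (hρ : ρ.IsHermitian)
    (hβ : β.PosSemidef) (hβ0 : 0 < β.trace.re) {C : ℝ} (hC : 0 < C)
    {L : Matrix n n ℂ →ₗ[ℂ] Matrix n n ℂ} (hL : IsBoundedMap (psdPow β (1 / 4)) C L)
    (G : K → R → Matrix n n ℂ) (hG : ∀ k r, G k r ∈ unitaryGroup n ℂ)
    (hGβ : ∀ k r, Commute (G k r) β)
    (horth : ∀ Z k k', k ≠ k' →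
      ∑ r, inner ℂ (vec (conjBy (G k r) (L Z))) (vec (conjBy (G k' r) (L Z))) = 0)
    {ε c : ℝ} (hc : 0 < c)
    (h : smoothRenyiTwo ε ρ β + log2 c⁻¹ < log2 (Fintype.card K)) :
    ∑ r, traceNorm (average (fun k => conjBy (G k r)) (L ρ))
      < Fintype.card R * (C * (ε * ρ.trace.re + Real.sqrt β.trace.re * Real.sqrt c)) := by
  have hK : (0 : ℝ) < Fintype.card K := by exact_mod_cast Fintype.card_pos
  have hR : (0 : ℝ) < Fintype.card R := by exact_mod_cast Fintype.card_pos
  obtain ⟨α, hα, hd, hs, hlt⟩ := exists_of_smoothRenyiTwo_add_lt hc hK h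
  have hg := psdPow_isHermitian β (1 / 4)
  have hg' := psdPow_isHermitian β (-(1 / 4))
  have hZ : (psdPow β (-(1 / 4)) * α * psdPow β (-(1 / 4))).IsHermitian := by
    have := isHermitian_mul_mul_conjTranspose (psdPow β (-(1 / 4))) hα.isHermitian
    rwa [hg'.eq] at this
  refine (sum_traceNorm_average_conjBy_le (δ := ε * ρ.trace.re) hg hL G hG
    (fun k r => commute_psdPow hβ.isHermitian (hGβ k r) _) hρ hZ
    (by rwa [psdPow_quarter_conj hα.isHermitian hβ hs]) (horth _)).trans_lt ?_
  rw [psdPow_quarter_pow hβ, norm_vec, mul_add C]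
  refine mul_lt_mul_of_pos_left (add_lt_add_right ?_ _) hR
  rw [mul_left_comm]
  refine mul_lt_mul_of_pos_left ?_ (Real.sqrt_pos.2 hβ0)
  rw [mul_div_assoc]
  refine mul_lt_mul_of_pos_left ?_ hC
  rwa [div_lt_iff₀ (Real.sqrt_pos.2 hK)]

end SmoothedBound

/-! ### Partial trace, mixed states and isometries -/

section PartialTrace

variable {x m : Type*} [Fintype x] [DecidableEq x] [Fintype m] [DecidableEq m]

/-- Partial trace over the first tensor factor. -/
def partialTraceLeft (Z : Matrix (x × m) (x × m) ℂ) : Matrix m m ℂ :=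
  ∑ i, Z.submatrix (fun p => (i, p)) (fun p => (i, p))

theorem partialTraceLeft_apply (Z : Matrix (x × m) (x × m) ℂ) (p q : m) :
    partialTraceLeft Z p q = ∑ i, Z (i, p) (i, q) := by
  simp [partialTraceLeft, Matrix.sum_apply]

theorem partialTraceLeft_posSemidef {Z : Matrix (x × m) (x × m) ℂ} (hZ : Z.PosSemidef) :
    (partialTraceLeft Z).PosSemidef :=
  posSemidef_sum _ fun _ _ => hZ.submatrix _

theorem trace_partialTraceLeft (Z : Matrix (x × m) (x × m) ℂ) :
    (partialTraceLeft Z).trace = Z.trace := by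
  simp only [Matrix.trace, diag_apply, partialTraceLeft_apply, Fintype.sum_prod_type]
  exact Finset.sum_comm

theorem trace_mixed [Nonempty x] : (mixed x).trace = 1 := by
  have : (Fintype.card x : ℂ) ≠ 0 := Nat.cast_ne_zero.2 Fintype.card_ne_zero
  simp [mixed, this]

theorem mixed_posSemidef : (mixed x).PosSemidef := by
  have h : (0 : ℂ) ≤ (Fintype.card x : ℂ)⁻¹ := inv_nonneg.2 (Nat.cast_nonneg _)
  exact PosSemidef.one.smul h

theorem partialTraceLeft_kronecker (M : Matrix x x ℂ) (Z : Matrix m m ℂ) :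
    partialTraceLeft (M ⊗ₖ Z) = M.trace • Z := by
  ext p q
  simp [partialTraceLeft_apply, Matrix.trace, Finset.sum_mul]

theorem partialTraceLeft_sub (Z Z' : Matrix (x × m) (x × m) ℂ) :
    partialTraceLeft (Z - Z') = partialTraceLeft Z - partialTraceLeft Z' := by
  ext p q
  simp [partialTraceLeft_apply]

theorem traceNorm_mixed_kronecker_le [Nonempty x] {Z : Matrix m m ℂ} (hZ : Z.IsHermitian) :
    traceNorm (mixed x ⊗ₖ Z) ≤ traceNorm Z := by
  obtain ⟨P, Q, hP, hQ, rfl, h⟩ := exists_posSemidef_sub hZ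
  have e : mixed x ⊗ₖ (P - Q) = mixed x ⊗ₖ P - mixed x ⊗ₖ Q := by
    ext i j; simp [mul_sub]
  rw [← h, e]
  refine (traceNorm_sub_le (mixed_posSemidef.kronecker hP) (mixed_posSemidef.kronecker hQ)).trans_eq
    ?_
  simp [trace_kronecker, trace_mixed]

theorem traceNorm_submatrix_le {n k : Type*} [Fintype n] [DecidableEq n] [Fintype k]
    [DecidableEq k] (e : k ≃ n) {Z : Matrix n n ℂ} (hZ : Z.IsHermitian) :
    traceNorm (Z.submatrix e e) ≤ traceNorm Z := by
  obtain ⟨P, Q, hP, hQ, rfl, h⟩ := exists_posSemidef_sub hZ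
  rw [← h]
  refine (traceNorm_sub_le (hP.submatrix e) (hQ.submatrix e)).trans_eq ?_
  simp only [Matrix.trace, diag_apply, submatrix_apply]
  rw [Equiv.sum_comp e (fun i => P i i), Equiv.sum_comp e (fun i => Q i i)]

theorem traceNorm_isometry_conj_le {n k : Type*} [Fintype n] [DecidableEq n] [Fintype k]
    [DecidableEq k] {J : Matrix k n ℂ} (hJ : Jᴴ * J = 1) {Z : Matrix n n ℂ} (hZ : Z.IsHermitian) :
    traceNorm (J * Z * Jᴴ) ≤ traceNorm Z := by
  obtain ⟨P, Q, hP, hQ, rfl, h⟩ := exists_posSemidef_sub hZ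
  rw [← h, Matrix.mul_sub, Matrix.sub_mul]
  refine (traceNorm_sub_le (hP.mul_mul_conjTranspose_same J)
    (hQ.mul_mul_conjTranspose_same J)).trans_eq ?_
  rw [Matrix.trace_mul_comm, ← Matrix.mul_assoc, hJ, one_mul, Matrix.trace_mul_comm (J * Q),
    ← Matrix.mul_assoc, hJ, one_mul]

end PartialTrace

/-! ### Twirling one tensor factor -/

section Twirl

variable {x m : Type*} [Fintype x] [DecidableEq x] [Fintype m] [DecidableEq m]

theorem kronecker_one_mem_unitaryGroup {G : Matrix x x ℂ} (hG : G ∈ unitaryGroup x ℂ) :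
    G ⊗ₖ (1 : Matrix m m ℂ) ∈ unitaryGroup (x × m) ℂ :=
  kronecker_mem_unitary hG (one_mem _)

/-- Each block of Z with fixed indices p, q is conjugated separately, so the design property on x
alone can be applied blockwise. -/
theorem kronecker_one_conj_apply (G : Matrix x x ℂ) (Z : Matrix (x × m) (x × m) ℂ) (i j : x)
    (p q : m) : ((G ⊗ₖ (1 : Matrix m m ℂ)) * Z * (G ⊗ₖ (1 : Matrix m m ℂ))ᴴ) (i, p) (j, q)
      = (G * (of fun i j => Z (i, p) (j, q)) * Gᴴ) i j := by
  simp [Matrix.mul_apply, Fintype.sum_prod_type, Matrix.one_apply, conjTranspose_kronecker,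
    apply_ite, Finset.sum_mul]

/-- A 1-design acting on the first tensor factor replaces that factor by the mixed state. -/
theorem IsOneDesign.average_conjBy {N : ℕ} {U : Fin N → Matrix x x ℂ} (hU : IsOneDesign U)
    (Z : Matrix (x × m) (x × m) ℂ) :
    average (fun d => conjBy (U d ⊗ₖ (1 : Matrix m m ℂ))) Z = mixed x ⊗ₖ partialTraceLeft Z := by
  ext ⟨i, p⟩ ⟨j, q⟩
  have h := congrFun (congrFun (hU.2 (of fun i j => Z (i, p) (j, q))) i) j
  rw [average_apply, Matrix.smul_apply, Matrix.sum_apply, Fintype.card_fin]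
  simp only [conjBy_apply, kronecker_one_conj_apply]
  rw [Matrix.smul_apply, Matrix.sum_apply] at h
  rw [h]
  simp [partialTraceLeft_apply, Matrix.trace, mul_comm]

theorem conjBy_mixed_kronecker {G : Matrix x x ℂ} (hG : G ∈ unitaryGroup x ℂ) (Z : Matrix m m ℂ) :
    conjBy (G ⊗ₖ (1 : Matrix m m ℂ)) (mixed x ⊗ₖ Z) = mixed x ⊗ₖ Z := by
  rw [conjBy_apply, conjTranspose_kronecker, ← mul_kronecker_mul, ← mul_kronecker_mul]
  simp only [mixed, conjTranspose_one, one_mul, mul_one, mul_smul_comm, smul_mul_assoc]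
  rw [← star_eq_conjTranspose, mem_unitaryGroup_iff.1 hG]

theorem average_const {n ι : Type*} [Fintype n] [DecidableEq n] [Fintype ι] [Nonempty ι]
    {L : ι → Matrix n n ℂ →ₗ[ℂ] Matrix n n ℂ} {Z Z' : Matrix n n ℂ} (h : ∀ i, L i Z = Z') :
    average L Z = Z' := by
  have : (Fintype.card ι : ℂ) ≠ 0 := Nat.cast_ne_zero.2 Fintype.card_ne_zero
  simp only [average_apply, h, Finset.sum_const, Finset.card_univ]
  rw [← Nat.cast_smul_eq_nsmul ℂ, smul_smul, inv_mul_cancel₀ this, one_smul]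

theorem sum_eq_zero_of_average_eq_zero {n ι : Type*} [Fintype n] [DecidableEq n] [Fintype ι]
    {L : ι → Matrix n n ℂ →ₗ[ℂ] Matrix n n ℂ} {Z : Matrix n n ℂ} (h : average L Z = 0) :
    ∑ i, L i Z = 0 := by
  rcases isEmpty_or_nonempty ι with hι | hι
  · simp
  · have : (Fintype.card ι : ℂ) ≠ 0 := Nat.cast_ne_zero.2 Fintype.card_ne_zero
    rw [average_apply] at h
    exact (smul_eq_zero.1 h).resolve_left (inv_ne_zero this)

/-- The twirl T is idempotent, so it kills the image of 1 - T. This supplies the zero sum required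
by `IsPairwiseIndependent.sum_inner_eq_zero`. -/
theorem IsOneDesign.average_conjBy_sub [Nonempty x] {N : ℕ} {U : Fin N → Matrix x x ℂ}
    (hU : IsOneDesign U) (Z : Matrix (x × m) (x × m) ℂ) :
    average (fun d => conjBy (U d ⊗ₖ (1 : Matrix m m ℂ)))
      (Z - average (fun d => conjBy (U d ⊗ₖ (1 : Matrix m m ℂ))) Z) = 0 := by
  rw [hU.average_conjBy, hU.average_conjBy, partialTraceLeft_sub, partialTraceLeft_kronecker,
    trace_mixed, one_smul, sub_self, kronecker_zero]

theorem commute_kronecker_one_mixed (G : Matrix x x ℂ) (Z : Matrix m m ℂ) :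
    Commute (G ⊗ₖ (1 : Matrix m m ℂ)) (mixed x ⊗ₖ Z) := by
  simp [Commute, SemiconjBy, ← mul_kronecker_mul, mixed]

/-- Decoupling of one tensor factor. -/
theorem sum_traceNorm_average_design_lt [Nonempty x] {K S : Type*} [Fintype K] [DecidableEq K]
    [Nonempty K] [Fintype S] [Nonempty S] {N : ℕ} {U : Fin N → Matrix x x ℂ}
    (hU : IsOneDesign U) {h : K → S → Fin N} (hh : IsPairwiseIndependent h)
    {ω : Matrix (x × m) (x × m) ℂ} (hω : ω.IsHermitian) {Z : Matrix m m ℂ} (hZ : Z.PosSemidef)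
    (hZ0 : 0 < Z.trace.re) {ε c : ℝ} (hc : 0 < c)
    (hlt : smoothRenyiTwo ε ω (mixed x ⊗ₖ Z) + log2 c⁻¹ < log2 (Fintype.card K)) :
    ∑ s, traceNorm (average (fun k => conjBy (U (h k s) ⊗ₖ (1 : Matrix m m ℂ)))
        (ω - mixed x ⊗ₖ partialTraceLeft ω))
      < Fintype.card S * (2 * (ε * ω.trace.re + Real.sqrt Z.trace.re * Real.sqrt c)) := by
  have htr : (mixed x ⊗ₖ Z).trace = Z.trace := by rw [trace_kronecker, trace_mixed, one_mul]
  have hβ := (mixed_posSemidef (x := x)).kronecker hZ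
  have hu : ∀ d, U d ⊗ₖ (1 : Matrix m m ℂ) ∈ unitaryGroup (x × m) ℂ := fun d =>
    kronecker_one_mem_unitaryGroup (hU.1 d)
  -- The constant 2 is 1 + 1, from the identity and the twirl.
  have hL : IsBoundedMap (psdPow (mixed x ⊗ₖ Z) (1 / 4)) 2 (LinearMap.id -
      average fun d => conjBy (U d ⊗ₖ (1 : Matrix m m ℂ))) := by
    have h2 : (2 : ℝ) = 1 + 1 := by norm_num
    exact h2 ▸ IsBoundedMap.id.sub (IsBoundedMap.average fun d => IsBoundedMap.conjBy (hu d)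
      (psdPow_isHermitian _ _) (commute_psdPow hβ.1 (commute_kronecker_one_mixed _ _) _))
  have := sum_traceNorm_average_conjBy_lt hω hβ (by rwa [htr]) two_pos hL
    (fun (k : K) (s : S) => U (h k s) ⊗ₖ (1 : Matrix m m ℂ)) (fun k s => hu _)
    (fun k s => commute_kronecker_one_mixed _ _)
    (fun Y k k' hk => hh.sum_inner_eq_zero hk (fun d => vec (conjBy (U d ⊗ₖ 1) _))
      (fun d => vec (conjBy (U d ⊗ₖ 1) _)) ?_) hc hlt
  · rw [htr] at this
    simpa only [LinearMap.sub_apply, LinearMap.id_apply, hU.average_conjBy] using this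
  · have h0 := sum_eq_zero_of_average_eq_zero (hU.average_conjBy_sub Y)
    rw [← map_sum, LinearMap.sub_apply, LinearMap.id_apply, h0, map_zero]

end Twirl

/-! ### Reindexing and composition of averages -/

section Submatrix

variable {n k ι : Type*} [Fintype n] [DecidableEq n] [Fintype k] [DecidableEq k] [Fintype ι]

theorem conjBy_submatrix (e : k ≃ n) (G Z : Matrix n n ℂ) :
    conjBy (G.submatrix e e) (Z.submatrix e e) = (conjBy G Z).submatrix e e := by
  simp only [conjBy_apply, conjTranspose_submatrix, submatrix_mul_equiv]

theorem average_conjBy_submatrix (e : k ≃ n) (G : ι → Matrix n n ℂ) (Z : Matrix n n ℂ) :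
    average (fun i => conjBy ((G i).submatrix e e)) (Z.submatrix e e)
      = (average (fun i => conjBy (G i)) Z).submatrix e e := by
  simp only [average_apply, conjBy_submatrix]
  ext i j
  simp [Matrix.sum_apply]

theorem conjBy_mul (G H Z : Matrix n n ℂ) : conjBy (G * H) Z = conjBy G (conjBy H Z) := by
  simp only [conjBy_apply, conjTranspose_mul, Matrix.mul_assoc]

theorem average_prod_conjBy_mul {κ : Type*} [Fintype κ] (G : ι → Matrix n n ℂ)
    (H : κ → Matrix n n ℂ) (Z : Matrix n n ℂ) :
    average (fun p : ι × κ => conjBy (G p.1 * H p.2)) Z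
      = average (fun i => conjBy (G i)) (average (fun j => conjBy (H j)) Z) := by
  simp only [average_apply, conjBy_mul, map_smul, map_sum, Fintype.sum_prod_type,
    Fintype.card_prod, Nat.cast_mul, mul_inv, ← Finset.smul_sum, smul_smul]
  rw [mul_comm, Finset.sum_comm]

theorem average_conjBy_comm {κ : Type*} [Fintype κ] {G : ι → Matrix n n ℂ} {H : κ → Matrix n n ℂ}
    (h : ∀ i j, Commute (G i) (H j)) (Z : Matrix n n ℂ) :
    average (fun i => conjBy (G i)) (average (fun j => conjBy (H j)) Z)
      = average (fun j => conjBy (H j)) (average (fun i => conjBy (G i)) Z) := by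
  have h' : ∀ i j Y, conjBy (G i) (conjBy (H j) Y) = conjBy (H j) (conjBy (G i) Y) :=
    fun i j Y => by rw [← conjBy_mul, (h i j).eq, conjBy_mul]
  simp only [average_apply, map_smul, map_sum, h']
  rw [← Finset.smul_sum, ← Finset.smul_sum, smul_comm, Finset.sum_comm]

end Submatrix

/-! ### The bipartite deviation and its decoupling -/

section Bipartite

variable {x y m : Type*} [Fintype x] [DecidableEq x] [Fintype y] [DecidableEq y]
  [Fintype m] [DecidableEq m]

/-- Exchange of the first two tensor factors. -/
def leftComm (x y m : Type*) : x × y × m ≃ y × x × m where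
  toFun p := (p.2.1, p.1, p.2.2)
  invFun p := (p.2.1, p.1, p.2.2)
  left_inv _ := rfl
  right_inv _ := rfl

/-- Swapping the first two factors lets results about the first factor be reused for Y. -/
theorem one_kronecker_eq_submatrix (G : Matrix y y ℂ) :
    (1 : Matrix x x ℂ) ⊗ₖ (G ⊗ₖ (1 : Matrix m m ℂ))
      = (G ⊗ₖ (1 : Matrix (x × m) (x × m) ℂ)).submatrix (leftComm x y m) (leftComm x y m) := by
  ext ⟨i, p, u⟩ ⟨j, q, v⟩
  simp [leftComm, Matrix.one_apply, ite_and, Prod.ext_iff]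
  split_ifs <;> rfl

theorem kronecker_one_one_eq_submatrix (G : Matrix x x ℂ) :
    G ⊗ₖ (1 : Matrix (y × m) (y × m) ℂ)
      = ((1 : Matrix y y ℂ) ⊗ₖ (G ⊗ₖ (1 : Matrix m m ℂ))).submatrix (leftComm x y m)
        (leftComm x y m) := by
  ext ⟨i, p, u⟩ ⟨j, q, v⟩
  simp [leftComm, Matrix.one_apply, ite_and, Prod.ext_iff]
  split_ifs <;> rfl

theorem marginalYM_eq (ρ : Matrix (x × y × m) (x × y × m) ℂ) :
    marginalYM ρ = partialTraceLeft ρ := by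
  ext i j; simp [marginalYM, partialTraceLeft_apply]

theorem marginalXM_eq (ρ : Matrix (x × y × m) (x × y × m) ℂ) :
    marginalXM ρ = partialTraceLeft (ρ.submatrix (leftComm y x m) (leftComm y x m)) := by
  ext i j; simp [marginalXM, partialTraceLeft_apply, leftComm]

theorem marginalM_eq_marginalYM (ρ : Matrix (x × y × m) (x × y × m) ℂ) :
    marginalM ρ = partialTraceLeft (marginalYM ρ) := by
  ext i j
  simp only [marginalM, marginalYM, partialTraceLeft_apply, of_apply]
  exact Finset.sum_comm

theorem marginalM_eq_marginalXM (ρ : Matrix (x × y × m) (x × y × m) ℂ) :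
    marginalM ρ = partialTraceLeft (marginalXM ρ) := by
  ext i j
  simp only [marginalM, marginalXM, partialTraceLeft_apply, of_apply]

theorem marginalXM_posSemidef {ρ : Matrix (x × y × m) (x × y × m) ℂ} (hρ : ρ.PosSemidef) :
    (marginalXM ρ).PosSemidef := by
  rw [marginalXM_eq]
  exact partialTraceLeft_posSemidef (hρ.submatrix _)

theorem marginalYM_posSemidef {ρ : Matrix (x × y × m) (x × y × m) ℂ} (hρ : ρ.PosSemidef) :
    (marginalYM ρ).PosSemidef := by
  rw [marginalYM_eq]
  exact partialTraceLeft_posSemidef hρ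

theorem marginalM_posSemidef {ρ : Matrix (x × y × m) (x × y × m) ℂ} (hρ : ρ.PosSemidef) :
    (marginalM ρ).PosSemidef := by
  rw [marginalM_eq_marginalYM]
  exact partialTraceLeft_posSemidef (marginalYM_posSemidef hρ)

theorem trace_marginalYM (ρ : Matrix (x × y × m) (x × y × m) ℂ) :
    (marginalYM ρ).trace = ρ.trace := by
  rw [marginalYM_eq, trace_partialTraceLeft]

theorem trace_marginalM (ρ : Matrix (x × y × m) (x × y × m) ℂ) :
    (marginalM ρ).trace = ρ.trace := by
  rw [marginalM_eq_marginalYM, trace_partialTraceLeft, trace_marginalYM]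

theorem trace_marginalXM (ρ : Matrix (x × y × m) (x × y × m) ℂ) :
    (marginalXM ρ).trace = ρ.trace := by
  rw [← trace_marginalM, marginalM_eq_marginalXM, trace_partialTraceLeft]

theorem IsOneDesign.average_conjBy_one_kronecker {N : ℕ} {W : Fin N → Matrix y y ℂ}
    (hW : IsOneDesign W) (Z : Matrix (x × y × m) (x × y × m) ℂ) :
    average (fun d => conjBy ((1 : Matrix x x ℂ) ⊗ₖ (W d ⊗ₖ (1 : Matrix m m ℂ)))) Z
      = (mixed y ⊗ₖ marginalXM Z).submatrix (leftComm x y m) (leftComm x y m) := by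
  have hZ : Z = (Z.submatrix (leftComm y x m) (leftComm y x m)).submatrix (leftComm x y m)
    (leftComm x y m) := rfl
  simp only [one_kronecker_eq_submatrix]
  rw [marginalXM_eq, ← hW.average_conjBy]
  conv_lhs => rw [hZ]
  exact average_conjBy_submatrix _ _ _

theorem commute_kronecker_one_one_kronecker (U : Matrix x x ℂ) (W : Matrix y y ℂ) :
    Commute (U ⊗ₖ (1 : Matrix (y × m) (y × m) ℂ))
      ((1 : Matrix x x ℂ) ⊗ₖ (W ⊗ₖ (1 : Matrix m m ℂ))) := by
  simp [Commute, SemiconjBy, ← mul_kronecker_mul]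

theorem one_kronecker_mem_unitaryGroup {W : Matrix y y ℂ} (hW : W ∈ unitaryGroup y ℂ) :
    (1 : Matrix x x ℂ) ⊗ₖ (W ⊗ₖ (1 : Matrix m m ℂ)) ∈ unitaryGroup (x × y × m) ℂ :=
  kronecker_mem_unitary (one_mem _) (kronecker_one_mem_unitaryGroup hW)

theorem conjBy_one_kronecker_submatrix {W : Matrix y y ℂ} (hW : W ∈ unitaryGroup y ℂ)
    (Z : Matrix (x × m) (x × m) ℂ) :
    conjBy ((1 : Matrix x x ℂ) ⊗ₖ (W ⊗ₖ (1 : Matrix m m ℂ)))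
      ((mixed y ⊗ₖ Z).submatrix (leftComm x y m) (leftComm x y m))
      = (mixed y ⊗ₖ Z).submatrix (leftComm x y m) (leftComm x y m) := by
  rw [one_kronecker_eq_submatrix, conjBy_submatrix, conjBy_mixed_kronecker hW]

theorem IsOneDesign.average_one_kronecker_sub [Nonempty y] {N : ℕ} {W : Fin N → Matrix y y ℂ}
    (hW : IsOneDesign W) (Z : Matrix (x × y × m) (x × y × m) ℂ) :
    average (fun d => conjBy ((1 : Matrix x x ℂ) ⊗ₖ (W d ⊗ₖ (1 : Matrix m m ℂ))))
      (Z - average (fun d => conjBy ((1 : Matrix x x ℂ) ⊗ₖ (W d ⊗ₖ (1 : Matrix m m ℂ)))) Z) = 0 := by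
  obtain ⟨Z, rfl⟩ : ∃ Y : Matrix (y × x × m) (y × x × m) ℂ,
    Z = Y.submatrix (leftComm x y m) (leftComm x y m) :=
    ⟨Z.submatrix (leftComm y x m) (leftComm y x m), rfl⟩
  simp only [one_kronecker_eq_submatrix]
  have hsub : ∀ Y Y' : Matrix (y × x × m) (y × x × m) ℂ,
    Y.submatrix (leftComm x y m) (leftComm x y m) - Y'.submatrix (leftComm x y m) (leftComm x y m)
      = (Y - Y').submatrix (leftComm x y m) (leftComm x y m) := fun _ _ => rfl
  rw [average_conjBy_submatrix, hsub, average_conjBy_submatrix, hW.average_conjBy_sub]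
  rfl

theorem kronecker_sub_right {p q : Type*} (M : Matrix p p ℂ) (Z Z' : Matrix q q ℂ) :
    M ⊗ₖ (Z - Z') = M ⊗ₖ Z - M ⊗ₖ Z' := by
  ext i j; simp [mul_sub]

theorem average_conjBy_one_kronecker {p q ι : Type*} [Fintype p] [DecidableEq p] [Fintype q]
    [DecidableEq q] [Fintype ι] (G : ι → Matrix q q ℂ) (M : Matrix p p ℂ) (Z : Matrix q q ℂ) :
    average (fun k => conjBy ((1 : Matrix p p ℂ) ⊗ₖ G k)) (M ⊗ₖ Z)
      = M ⊗ₖ average (fun k => conjBy (G k)) Z := by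
  have h : ∀ k, conjBy ((1 : Matrix p p ℂ) ⊗ₖ G k) (M ⊗ₖ Z) = M ⊗ₖ conjBy (G k) Z := fun k => by
    rw [conjBy_apply, conjTranspose_kronecker, ← mul_kronecker_mul, ← mul_kronecker_mul,
      conjTranspose_one, one_mul, mul_one, conjBy_apply]
  simp only [average_apply, h]
  ext i j
  simp only [Matrix.smul_apply, Matrix.sum_apply, kroneckerMap_apply, smul_eq_mul, Finset.mul_sum]
  exact Finset.sum_congr rfl fun k _ => by ring

section Decoupling

variable {K K' S S' : Type*} [Fintype K] [DecidableEq K] [Nonempty K] [Fintype K']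
  [DecidableEq K'] [Nonempty K'] [Fintype S] [Nonempty S] [Fintype S'] [Nonempty S']
  {N N' : ℕ} {U : Fin N → Matrix x x ℂ} {W : Fin N' → Matrix y y ℂ}
  {h : K → S → Fin N} {h' : K' → S' → Fin N'}

/-- The part of `ρ` that is traceless on both of the first two tensor factors. -/
noncomputable def bipartiteDeviation (ρ : Matrix (x × y × m) (x × y × m) ℂ) :
    Matrix (x × y × m) (x × y × m) ℂ :=
  ρ - (mixed y ⊗ₖ marginalXM ρ).submatrix (leftComm x y m) (leftComm x y m)
    - mixed x ⊗ₖ marginalYM ρ + mixed x ⊗ₖ (mixed y ⊗ₖ marginalM ρ)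

theorem marginalYM_submatrix_leftComm (Z : Matrix (x × m) (x × m) ℂ) :
    marginalYM ((mixed y ⊗ₖ Z).submatrix (leftComm x y m) (leftComm x y m))
      = mixed y ⊗ₖ partialTraceLeft Z := by
  ext i j
  simp [marginalYM, partialTraceLeft_apply, leftComm, Finset.mul_sum]

/-- The one-shot bound is applied with the product unitaries indexed by pairs in K × K' and L =
(1-T_X)(1-T_Y), whose bound is 2·2 = 4. Both twirls annihilate L, which is needed because two
distinct index pairs may agree in one coordinate. -/
theorem sum_traceNorm_average_bipartiteDeviation_lt [Nonempty x] [Nonempty y]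
    (hU : IsOneDesign U) (hW : IsOneDesign W)
    (hh : IsPairwiseIndependent h) (hh' : IsPairwiseIndependent h')
    {ρ : Matrix (x × y × m) (x × y × m) ℂ} (hρ : ρ.PosSemidef) (hρ0 : 0 < ρ.trace.re)
    {ε c : ℝ} (hc : 0 < c)
    (hlt : smoothRenyiTwo ε ρ (mixed x ⊗ₖ (mixed y ⊗ₖ marginalM ρ)) + log2 c⁻¹
      < log2 (Fintype.card (K × K'))) :
    ∑ r : S × S', traceNorm (average (fun k => conjBy (U (h k r.1) ⊗ₖ 1))
        (average (fun k => conjBy (1 ⊗ₖ (W (h' k r.2) ⊗ₖ 1))) (bipartiteDeviation ρ)))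
      < Fintype.card (S × S') *
        (4 * (ε * ρ.trace.re + Real.sqrt ρ.trace.re * Real.sqrt c)) := by
  have hβ := (mixed_posSemidef (x := x)).kronecker
    ((mixed_posSemidef (x := y)).kronecker (marginalM_posSemidef hρ))
  set β := mixed x ⊗ₖ (mixed y ⊗ₖ marginalM ρ) with hβdef
  have htr : β.trace = ρ.trace := by
    rw [hβdef, trace_kronecker, trace_kronecker, trace_mixed, trace_mixed, one_mul, one_mul,
      trace_marginalM]
  let E : Fin N → Matrix (x × y × m) (x × y × m) ℂ := fun d => U d ⊗ₖ 1
  let F : Fin N' → Matrix (x × y × m) (x × y × m) ℂ := fun e => 1 ⊗ₖ (W e ⊗ₖ 1)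
  have hE : ∀ d, E d ∈ unitaryGroup (x × y × m) ℂ := fun d =>
    kronecker_one_mem_unitaryGroup (hU.1 d)
  have hF : ∀ e, F e ∈ unitaryGroup (x × y × m) ℂ := fun e =>
    one_kronecker_mem_unitaryGroup (hW.1 e)
  have hEF : ∀ d e, Commute (E d) (F e) := fun d e => commute_kronecker_one_one_kronecker _ _
  have hEβ : ∀ d, Commute (E d) β := fun d => commute_kronecker_one_mixed _ _
  have hFβ : ∀ e, Commute (F e) β := fun e => by
    simp [F, hβdef, Commute, SemiconjBy, ← mul_kronecker_mul, mixed]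
  let TX := average fun d => conjBy (E d)
  let TY := average fun e => conjBy (F e)
  have hTX : IsBoundedMap (psdPow β (1 / 4)) 1 TX :=
    IsBoundedMap.average fun d => IsBoundedMap.conjBy (hE d) (psdPow_isHermitian _ _)
      (commute_psdPow hβ.1 (hEβ d) _)
  have hTY : IsBoundedMap (psdPow β (1 / 4)) 1 TY :=
    IsBoundedMap.average fun e => IsBoundedMap.conjBy (hF e) (psdPow_isHermitian _ _)
      (commute_psdPow hβ.1 (hFβ e) _)
  have hL : IsBoundedMap (psdPow β (1 / 4)) 4
      ((LinearMap.id - TX) ∘ₗ (LinearMap.id - TY)) := by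
    have h4 : (4 : ℝ) = (1 + 1) * (1 + 1) := by norm_num
    exact h4 ▸ (IsBoundedMap.id.sub hTX).comp (IsBoundedMap.id.sub hTY)
  have hcomm : ∀ Z, TX (TY Z) = TY (TX Z) := fun Z => average_conjBy_comm hEF Z
  have hX0 : ∀ Z, ∑ d, conjBy (E d) (((LinearMap.id - TX) ∘ₗ (LinearMap.id - TY)) Z) = 0 :=
    fun Z => sum_eq_zero_of_average_eq_zero (hU.average_conjBy_sub _)
  -- Since the twirls commute, the factor 1 - T_Y can be moved to the outside.
  have hY0 : ∀ Z, ∑ e, conjBy (F e) (((LinearMap.id - TX) ∘ₗ (LinearMap.id - TY)) Z) = 0 :=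
    fun Z => by
      have e : ((LinearMap.id - TX) ∘ₗ (LinearMap.id - TY)) Z = (Z - TX Z) - TY (Z - TX Z) := by
        simp only [LinearMap.comp_apply, LinearMap.sub_apply, LinearMap.id_apply, map_sub, hcomm]
      rw [e]
      exact sum_eq_zero_of_average_eq_zero (hW.average_one_kronecker_sub _)
  have hdev : ((LinearMap.id - TX) ∘ₗ (LinearMap.id - TY)) ρ = bipartiteDeviation ρ := by
    simp only [LinearMap.comp_apply, LinearMap.sub_apply, LinearMap.id_apply, map_sub]
    simp only [TX, TY, E, F, hU.average_conjBy, hW.average_conjBy_one_kronecker]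
    rw [← marginalYM_eq, ← marginalYM_eq, marginalYM_submatrix_leftComm, ← marginalM_eq_marginalXM,
      bipartiteDeviation]
    abel
  have key := sum_traceNorm_average_conjBy_lt hρ.1 hβ (by rwa [htr]) four_pos hL
    (fun (k : K × K') (r : S × S') => E (h k.1 r.1) * F (h' k.2 r.2))
    (fun k r => mul_mem (hE _) (hF _))
    (fun k r => (hEβ _).mul_left (hFβ _)) ?_ hc hlt
  · rw [htr, hdev] at key
    refine lt_of_eq_of_lt (Finset.sum_congr rfl fun r _ => ?_) key
    rw [average_prod_conjBy_mul (fun k => E (h k r.1)) (fun k => F (h' k r.2))]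
  · rintro Z ⟨a, b⟩ ⟨a', b'⟩ hk
    rw [Fintype.sum_prod_type]
    -- If the X indices agree, the Y indices differ and the sum over t vanishes for each s;
    -- otherwise the sum over s vanishes for each t.
    by_cases ha : a = a'
    · have hb : b ≠ b' := fun hb => hk (by rw [ha, hb])
      refine Finset.sum_eq_zero fun s _ => ?_
      simp only
      refine hh'.sum_inner_eq_zero hb (fun e => vec (conjBy (E (h a s) * F e) _))
        (fun e => vec (conjBy (E (h a' s) * F e) _)) ?_
      simp only [conjBy_mul]
      rw [← map_sum, ← map_sum, hY0, map_zero, map_zero]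
    · rw [Finset.sum_comm]
      refine Finset.sum_eq_zero fun t _ => ?_
      simp only
      refine hh.sum_inner_eq_zero ha (fun d => vec (conjBy (E d * F (h' b t)) _))
        (fun d => vec (conjBy (E d * F (h' b' t)) _)) ?_
      simp only [(hEF _ _).eq, conjBy_mul]
      rw [← map_sum, ← map_sum, hX0, map_zero, map_zero]

/-- Telescoping decomposition of the deviation from the decoupled state for fixed seeds. -/
theorem average_average_sub_eq (hU : ∀ d, U d ∈ unitaryGroup x ℂ)
    (hW : ∀ d, W d ∈ unitaryGroup y ℂ) (f : K → Fin N) (f' : K' → Fin N')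
    (ρ : Matrix (x × y × m) (x × y × m) ℂ) :
    average (fun k => conjBy (U (f k) ⊗ₖ 1)) (average (fun k => conjBy (1 ⊗ₖ (W (f' k) ⊗ₖ 1))) ρ)
        - mixed x ⊗ₖ (mixed y ⊗ₖ marginalM ρ)
      = average (fun k => conjBy (U (f k) ⊗ₖ 1))
          (average (fun k => conjBy (1 ⊗ₖ (W (f' k) ⊗ₖ 1))) (bipartiteDeviation ρ))
        + (mixed y ⊗ₖ (average (fun k => conjBy (U (f k) ⊗ₖ (1 : Matrix m m ℂ)))
            (marginalXM ρ - mixed x ⊗ₖ marginalM ρ))).submatrix (leftComm x y m) (leftComm x y m)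
        + mixed x ⊗ₖ (average (fun k => conjBy (W (f' k) ⊗ₖ (1 : Matrix m m ℂ)))
            (marginalYM ρ - mixed y ⊗ₖ marginalM ρ)) := by
  have hX : ∀ Z : Matrix (y × m) (y × m) ℂ,
      average (fun k => conjBy (U (f k) ⊗ₖ 1)) (mixed x ⊗ₖ Z) = mixed x ⊗ₖ Z := fun Z =>
    average_const fun k => conjBy_mixed_kronecker (hU _) Z
  have hX' : ∀ Z : Matrix m m ℂ,
      average (fun k => conjBy (U (f k) ⊗ₖ 1)) (mixed x ⊗ₖ Z) = mixed x ⊗ₖ Z := fun Z =>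
    average_const fun k => conjBy_mixed_kronecker (hU _) Z
  have hY' : ∀ Z : Matrix m m ℂ,
      average (fun k => conjBy (W (f' k) ⊗ₖ 1)) (mixed y ⊗ₖ Z) = mixed y ⊗ₖ Z := fun Z =>
    average_const fun k => conjBy_mixed_kronecker (hW _) Z
  have hY : ∀ Z : Matrix (x × m) (x × m) ℂ,
      average (fun k => conjBy ((1 : Matrix x x ℂ) ⊗ₖ (W (f' k) ⊗ₖ (1 : Matrix m m ℂ))))
        ((mixed y ⊗ₖ Z).submatrix (leftComm x y m) (leftComm x y m))
      = (mixed y ⊗ₖ Z).submatrix (leftComm x y m) (leftComm x y m) := fun Z =>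
    average_const fun k => conjBy_one_kronecker_submatrix (hW _) Z
  have hWX : ∀ Z : Matrix (y × m) (y × m) ℂ,
      average (fun k => conjBy ((1 : Matrix x x ℂ) ⊗ₖ (W (f' k) ⊗ₖ (1 : Matrix m m ℂ))))
        (mixed x ⊗ₖ Z)
      = mixed x ⊗ₖ average (fun k => conjBy (W (f' k) ⊗ₖ (1 : Matrix m m ℂ))) Z := fun Z =>
    average_conjBy_one_kronecker _ _ _
  have hUY : ∀ Z : Matrix (x × m) (x × m) ℂ,
      average (fun k => conjBy (U (f k) ⊗ₖ (1 : Matrix (y × m) (y × m) ℂ)))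
        ((mixed y ⊗ₖ Z).submatrix (leftComm x y m) (leftComm x y m))
      = (mixed y ⊗ₖ average (fun k => conjBy (U (f k) ⊗ₖ (1 : Matrix m m ℂ))) Z).submatrix
          (leftComm x y m) (leftComm x y m) := fun Z => by
    simp only [kronecker_one_one_eq_submatrix]
    rw [average_conjBy_submatrix, average_conjBy_one_kronecker]
  have hsub : ∀ Y Y' : Matrix (y × x × m) (y × x × m) ℂ,
    (Y - Y').submatrix (leftComm x y m) (leftComm x y m) =
      Y.submatrix (leftComm x y m) (leftComm x y m) - Y'.submatrix (leftComm x y m) (leftComm x y m)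
      := fun _ _ => rfl
  have hswap : (mixed y ⊗ₖ (mixed x ⊗ₖ marginalM ρ)).submatrix (leftComm x y m) (leftComm x y m)
      = mixed x ⊗ₖ (mixed y ⊗ₖ marginalM ρ) := by
    ext i j
    simp only [leftComm, Equiv.coe_fn_mk, submatrix_apply, kroneckerMap_apply]
    ring
  -- Conjugation on one system fixes a mixed state there, so the correction terms subtracted in the
  -- deviation cancel against the two marginal terms.
  rw [bipartiteDeviation]
  simp only [map_sub, map_add, hX', hY', hY, hWX, hX, hUY, kronecker_sub_right, hsub, hswap]
  abel

end Decoupling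

end Bipartite

/-! ### Seed registers as block decompositions -/

section Embedding

variable {x y m S T : Type*} [Fintype x] [DecidableEq x] [Fintype y] [DecidableEq y]
  [Fintype m] [DecidableEq m] [Fintype S] [DecidableEq S] [Fintype T] [DecidableEq T]

/-- The isometry adjoining the basis vector `s` of a seed register. -/
def adjoin (x : Type*) [DecidableEq x] (s : S) : Matrix (x × S) x ℂ :=
  of fun i p => if i.1 = p ∧ i.2 = s then 1 else 0

theorem adjoin_isometry (s : S) : (adjoin x s)ᴴ * adjoin x s = 1 := by
  ext p q
  simp [adjoin, Matrix.mul_apply, Fintype.sum_prod_type, Matrix.one_apply, ite_and, apply_ite,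
    eq_comm]

/-- The seed-controlled unitary acts as `G s` on the branch with seed s. -/
theorem sum_kronecker_single_mul_adjoin (G : S → Matrix x x ℂ) (s : S) :
    (∑ s', G s' ⊗ₖ Matrix.single s' s' (1 : ℂ)) * adjoin x s = adjoin x s * G s := by
  ext ⟨i, t⟩ p
  simp only [adjoin, Matrix.mul_apply, of_apply, Matrix.sum_apply, kroneckerMap_apply,
    Fintype.sum_prod_type, Matrix.single_apply]
  by_cases h : t = s
  · subst h
    simp [ite_and]
  · simp [ite_and, h, eq_comm]

/-- The isometry adjoining basis vectors to both seed registers. -/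
def adjoinBoth (x y m : Type*) [DecidableEq x] [DecidableEq y] [DecidableEq m] (r : S × T) :
    Matrix ((x × S) × (y × T) × m) (x × y × m) ℂ :=
  adjoin x r.1 ⊗ₖ (adjoin y r.2 ⊗ₖ (1 : Matrix m m ℂ))

theorem adjoinBoth_isometry (r : S × T) : (adjoinBoth x y m r)ᴴ * adjoinBoth x y m r = 1 := by
  simp [adjoinBoth, conjTranspose_kronecker, ← mul_kronecker_mul, adjoin_isometry]

theorem adjoinBoth_conj_apply (r : S × T) (ω : Matrix (x × y × m) (x × y × m) ℂ)
    (i j : (x × S) × (y × T) × m) :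
    (adjoinBoth x y m r * ω * (adjoinBoth x y m r)ᴴ) i j =
      if r = (i.1.2, i.2.1.2) ∧ r = (j.1.2, j.2.1.2) then
        ω (i.1.1, i.2.1.1, i.2.2) (j.1.1, j.2.1.1, j.2.2) else 0 := by
  obtain ⟨⟨i1, s⟩, ⟨i2, t⟩, i3⟩ := i
  obtain ⟨⟨j1, s'⟩, ⟨j2, t'⟩, j3⟩ := j
  obtain ⟨a, b⟩ := r
  simp only [adjoinBoth, adjoin, Matrix.mul_apply, conjTranspose_apply, kroneckerMap_apply,
    of_apply, Fintype.sum_prod_type, Matrix.one_apply, Prod.mk.injEq]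
  by_cases h1 : s = a <;> by_cases h2 : t = b <;> by_cases h3 : s' = a <;> by_cases h4 : t' = b <;>
    simp [h1, h2, h3, h4, eq_comm, apply_ite]

end Embedding

/-! ### Assembly of the three bounds -/

section Main

variable {x y m : Type*} [Fintype x] [DecidableEq x] [Fintype y] [DecidableEq y]
  [Fintype m] [DecidableEq m]

theorem withCatalyst_eq_sum (ω : Matrix (x × y × m) (x × y × m) ℂ) :
    withCatalyst ω = (Fintype.card (Four x × Four y) : ℂ)⁻¹ •
      ∑ r, adjoinBoth x y m r * ω * (adjoinBoth x y m r)ᴴ := by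
  ext i j
  simp only [withCatalyst, mixed, Matrix.smul_apply, Matrix.sum_apply, adjoinBoth_conj_apply,
    reindex_apply, submatrix_apply, kroneckerMap_apply, rearrange, Equiv.coe_fn_symm_mk,
    Matrix.one_apply, ite_and, Finset.sum_ite_eq', Finset.mem_univ, if_true, smul_eq_mul]
  split_ifs <;> ring

/-- The mixed catalyst is a uniform mixture of seed branches, and the controlled unitaries preserve
each branch, so the difference splits seed by seed. -/
theorem convexSplitState_sub_decoupledState {A B N N' : ℕ} {U : Fin N → Matrix x x ℂ}
    {W : Fin N' → Matrix y y ℂ} (h : Fin A → Four x → Fin N) (h' : Fin B → Four y → Fin N')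
    (ρ : Matrix (x × y × m) (x × y × m) ℂ) :
    convexSplitState (fun k => ∑ s, U (h k s) ⊗ₖ Matrix.single s s (1 : ℂ))
        (fun k => ∑ s, W (h' k s) ⊗ₖ Matrix.single s s (1 : ℂ)) ρ - decoupledState ρ
      = (Fintype.card (Four x × Four y) : ℂ)⁻¹ • ∑ r, adjoinBoth x y m r *
        (average (fun k => conjBy (U (h k r.1) ⊗ₖ 1))
          (average (fun k => conjBy (1 ⊗ₖ (W (h' k r.2) ⊗ₖ 1))) ρ)
          - mixed x ⊗ₖ (mixed y ⊗ₖ marginalM ρ)) * (adjoinBoth x y m r)ᴴ := by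
  set V' : Fin A → Matrix (x × Four x) (x × Four x) ℂ :=
    fun k => ∑ s, U (h k s) ⊗ₖ Matrix.single s s (1 : ℂ) with hV'
  set W' : Fin B → Matrix (y × Four y) (y × Four y) ℂ :=
    fun k => ∑ s, W (h' k s) ⊗ₖ Matrix.single s s (1 : ℂ) with hW'
  have hconj : ∀ a b r, (V' a ⊗ₖ (W' b ⊗ₖ (1 : Matrix m m ℂ))) *
      (adjoinBoth x y m r * ρ * (adjoinBoth x y m r)ᴴ) *
      (V' a ⊗ₖ (W' b ⊗ₖ (1 : Matrix m m ℂ)))ᴴ = adjoinBoth x y m r *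
        conjBy ((U (h a r.1) ⊗ₖ (1 : Matrix (y × m) (y × m) ℂ)) *
          ((1 : Matrix x x ℂ) ⊗ₖ (W (h' b r.2) ⊗ₖ (1 : Matrix m m ℂ)))) ρ * (adjoinBoth x y m r)ᴴ := by
    intro a b r
    have e : (V' a ⊗ₖ (W' b ⊗ₖ (1 : Matrix m m ℂ))) * adjoinBoth x y m r
        = adjoinBoth x y m r * ((U (h a r.1) ⊗ₖ (1 : Matrix (y × m) (y × m) ℂ)) *
          ((1 : Matrix x x ℂ) ⊗ₖ (W (h' b r.2) ⊗ₖ (1 : Matrix m m ℂ)))) := by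
      simp only [adjoinBoth, ← mul_kronecker_mul, mul_one, one_mul]
      rw [hV', hW', sum_kronecker_single_mul_adjoin (fun s => U (h a s)),
        sum_kronecker_single_mul_adjoin (fun s => W (h' b s))]
    rw [conjBy_apply]
    calc _ = ((V' a ⊗ₖ (W' b ⊗ₖ (1 : Matrix m m ℂ))) * adjoinBoth x y m r) * ρ *
          ((V' a ⊗ₖ (W' b ⊗ₖ (1 : Matrix m m ℂ))) * adjoinBoth x y m r)ᴴ := by
          simp only [conjTranspose_mul, Matrix.mul_assoc]
      _ = _ := by rw [e]; simp only [conjTranspose_mul, Matrix.mul_assoc]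
  have hσ : convexSplitState V' W' ρ = (Fintype.card (Four x × Four y) : ℂ)⁻¹ •
      ∑ r, adjoinBoth x y m r * (average (fun k => conjBy (U (h k r.1) ⊗ₖ 1))
        (average (fun k => conjBy (1 ⊗ₖ (W (h' k r.2) ⊗ₖ 1))) ρ)) * (adjoinBoth x y m r)ᴴ := by
    have e : ∀ r : Four x × Four y, average (fun k => conjBy (U (h k r.1) ⊗ₖ 1))
        (average (fun k => conjBy (1 ⊗ₖ (W (h' k r.2) ⊗ₖ 1))) ρ)
        = ((A : ℂ) * (B : ℂ))⁻¹ • ∑ a, ∑ b, conjBy ((U (h a r.1) ⊗ₖ 1) *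
          (1 ⊗ₖ (W (h' b r.2) ⊗ₖ (1 : Matrix m m ℂ)))) ρ := fun r => by
      rw [← average_prod_conjBy_mul, average_apply, Fintype.sum_prod_type]
      simp
    simp only [e]
    rw [convexSplitState, withCatalyst_eq_sum]
    simp only [mul_smul_comm, smul_mul_assoc, Matrix.mul_smul, Matrix.smul_mul, Finset.mul_sum,
      Finset.sum_mul, Matrix.mul_sum, Matrix.sum_mul, hconj, ← Finset.smul_sum]
    rw [smul_comm]
    congr 2
    rw [Finset.sum_congr rfl fun a _ => Finset.sum_comm, Finset.sum_comm]
  rw [hσ, decoupledState, withCatalyst_eq_sum, ← smul_sub, ← Finset.sum_sub_distrib]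
  simp only [Matrix.mul_sub, Matrix.sub_mul]

theorem isHermitian_mixed_kronecker {q : Type*} {Z : Matrix q q ℂ} (hZ : Z.IsHermitian) :
    (mixed x ⊗ₖ Z).IsHermitian := by
  rw [IsHermitian, conjTranspose_kronecker, hZ.eq, mixed_posSemidef.1.eq]

theorem isHermitian_average_conjBy {n ι : Type*} [Fintype n] [DecidableEq n] [Fintype ι]
    {G : ι → Matrix n n ℂ} (hG : ∀ i, G i ∈ unitaryGroup n ℂ) {Z : Matrix n n ℂ}
    (hZ : Z.IsHermitian) : (average (fun i => conjBy (G i)) Z).IsHermitian :=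
  (IsBoundedMap.average fun i => IsBoundedMap.conjBy (g := 1) (hG i) isHermitian_one
    (Commute.one_right _)).isHermitian Z hZ

theorem re_trace_pos {n : Type*} [Fintype n] {M : Matrix n n ℂ} (hM : M.PosSemidef) (hM0 : M ≠ 0) :
    0 < M.trace.re := by
  have h0 := Complex.le_def.1 hM.trace_nonneg
  refine lt_of_le_of_ne h0.1 fun h => hM0 (hM.trace_eq_zero_iff.1 ?_)
  exact Complex.ext h.symm h0.2.symm

/-- Common source of both bounds of the theorem. The triangle inequality over seed branches and over
the three telescoping terms gives 4 + 2 + 2 = 8 times the same error. -/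
theorem traceNorm_convexSplitState_sub_lt (ρ : Matrix (x × y × m) (x × y × m) ℂ)
    (hρ : ρ.PosSemidef) (hρ0 : 0 < ρ.trace.re) {A B : ℕ} (hA : 0 < A) (hB : 0 < B) {ε c : ℝ}
    (hc : 0 < c)
    {V : Fin A → Matrix (x × Four x) (x × Four x) ℂ} (hV : IsHashDesignFamily V)
    {W : Fin B → Matrix (y × Four y) (y × Four y) ℂ} (hW : IsHashDesignFamily W)
    (hXM : smoothRenyiTwo ε (marginalXM ρ) (mixed x ⊗ₖ marginalM ρ) + log2 c⁻¹ < log2 A)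
    (hYM : smoothRenyiTwo ε (marginalYM ρ) (mixed y ⊗ₖ marginalM ρ) + log2 c⁻¹ < log2 B)
    (hXYM : smoothRenyiTwo ε ρ (mixed x ⊗ₖ (mixed y ⊗ₖ marginalM ρ)) + log2 c⁻¹
      < log2 A + log2 B) :
    traceNorm (convexSplitState V W ρ - decoupledState ρ)
      < 8 * (ε * ρ.trace.re + Real.sqrt ρ.trace.re * Real.sqrt c) := by
  obtain ⟨N, U, h, hU, hh, hVeq⟩ := hV
  obtain ⟨N', U', h', hU', hh', hWeq⟩ := hW
  obtain rfl : V = fun k => ∑ s, U (h k s) ⊗ₖ Matrix.single s s (1 : ℂ) := funext hVeq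
  obtain rfl : W = fun k => ∑ s, U' (h' k s) ⊗ₖ Matrix.single s s (1 : ℂ) := funext hWeq
  have hne : Nonempty (x × y × m) := by
    by_contra hempty
    rw [not_nonempty_iff] at hempty
    simp [Matrix.trace] at hρ0
  obtain ⟨i, j, -⟩ := hne
  have : Nonempty x := ⟨i⟩
  have : Nonempty y := ⟨j⟩
  have : Nonempty (Fin A) := ⟨⟨0, hA⟩⟩
  have : Nonempty (Fin B) := ⟨⟨0, hB⟩⟩
  have hAB : log2 (Fintype.card (Fin A × Fin B)) = log2 A + log2 B := by
    rw [← log2_mul (by exact_mod_cast hA) (by exact_mod_cast hB)]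
    simp
  have hM := marginalM_posSemidef hρ
  have hMtr := trace_marginalM ρ
  have b1 := sum_traceNorm_average_bipartiteDeviation_lt hU hU' hh hh' hρ hρ0 hc (hAB ▸ hXYM)
  have b2 := sum_traceNorm_average_design_lt hU hh (marginalXM_posSemidef hρ).1 hM
    (by rwa [hMtr]) hc (by simpa using hXM)
  have b3 := sum_traceNorm_average_design_lt hU' hh' (marginalYM_posSemidef hρ).1 hM
    (by rwa [hMtr]) hc (by simpa using hYM)
  rw [← marginalM_eq_marginalXM, trace_marginalXM, hMtr] at b2
  rw [← marginalM_eq_marginalYM, trace_marginalYM, hMtr] at b3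
  rw [convexSplitState_sub_decoupledState]
  set a₁ : Four x × Four y → ℝ := fun r => traceNorm (average (fun k => conjBy (U (h k r.1) ⊗ₖ 1))
    (average (fun k => conjBy (1 ⊗ₖ (U' (h' k r.2) ⊗ₖ 1))) (bipartiteDeviation ρ))) with ha₁
  set a₂ : Four x → ℝ := fun s => traceNorm (average (fun k => conjBy (U (h k s) ⊗ₖ 1))
    (marginalXM ρ - mixed x ⊗ₖ marginalM ρ)) with ha₂
  set a₃ : Four y → ℝ := fun t => traceNorm (average (fun k => conjBy (U' (h' k t) ⊗ₖ 1))
    (marginalYM ρ - mixed y ⊗ₖ marginalM ρ)) with ha₃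
  have hXherm : ((mixed x ⊗ₖ marginalM ρ)).IsHermitian := (mixed_posSemidef.kronecker hM).1
  have hYherm : ((mixed y ⊗ₖ marginalM ρ)).IsHermitian := (mixed_posSemidef.kronecker hM).1
  have hdev : (bipartiteDeviation ρ).IsHermitian :=
    ((hρ.1.sub ((mixed_posSemidef.kronecker (marginalXM_posSemidef hρ)).1.submatrix _)).sub
      (mixed_posSemidef.kronecker (marginalYM_posSemidef hρ)).1).add
      (mixed_posSemidef.kronecker (mixed_posSemidef.kronecker hM)).1
  have hE₁ : ∀ r : Four x × Four y, (average (fun k => conjBy (U (h k r.1) ⊗ₖ 1))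
      (average (fun k => conjBy (1 ⊗ₖ (U' (h' k r.2) ⊗ₖ 1))) (bipartiteDeviation ρ))).IsHermitian :=
    fun r => isHermitian_average_conjBy (fun k => kronecker_one_mem_unitaryGroup (hU.1 _))
      (isHermitian_average_conjBy (fun k => one_kronecker_mem_unitaryGroup (hU'.1 _)) hdev)
  have hE₂ : ∀ s, (average (fun k => conjBy (U (h k s) ⊗ₖ 1))
      (marginalXM ρ - mixed x ⊗ₖ marginalM ρ)).IsHermitian := fun s =>
    isHermitian_average_conjBy (fun k => kronecker_one_mem_unitaryGroup (hU.1 _))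
      ((marginalXM_posSemidef hρ).1.sub hXherm)
  have hE₃ : ∀ t, (average (fun k => conjBy (U' (h' k t) ⊗ₖ 1))
      (marginalYM ρ - mixed y ⊗ₖ marginalM ρ)).IsHermitian := fun t =>
    isHermitian_average_conjBy (fun k => kronecker_one_mem_unitaryGroup (hU'.1 _))
      ((marginalYM_posSemidef hρ).1.sub hYherm)
  have hF₂ := fun s => (isHermitian_mixed_kronecker (x := y) (hE₂ s)).submatrix (leftComm x y m)
  have hF₃ := fun t => isHermitian_mixed_kronecker (x := x) (hE₃ t)
  simp only [average_average_sub_eq hU.1 hU'.1]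
  have hsum := fun r : Four x × Four y => ((hE₁ r).add (hF₂ r.1)).add (hF₃ r.2)
  have hJ := fun r : Four x × Four y => isHermitian_mul_mul_conjTranspose (adjoinBoth x y m r) (hsum r)
  have hcard : ((Fintype.card (Four x × Four y) : ℝ)) =
      (Fintype.card (Four x) : ℝ) * Fintype.card (Four y) := by
    rw [Fintype.card_prod, Nat.cast_mul]
  have h1 : (0 : ℝ) < Fintype.card (Four x) := by exact_mod_cast Fintype.card_pos
  have h2 : (0 : ℝ) < Fintype.card (Four y) := by exact_mod_cast Fintype.card_pos
  have hle := traceNorm_smul_le (c := (Fintype.card (Four x × Four y) : ℝ)⁻¹) (by positivity)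
    (isSelfAdjoint_sum Finset.univ fun r _ => hJ r)
  push_cast only [Complex.ofReal_inv, Complex.ofReal_natCast] at hle
  refine hle.trans_lt ?_
  have hbound : ∑ r : Four x × Four y, (a₁ r + a₂ r.1 + a₃ r.2)
      < (Fintype.card (Four x × Four y) : ℝ)
        * (8 * (ε * ρ.trace.re + Real.sqrt ρ.trace.re * Real.sqrt c)) := by
    rw [Finset.sum_add_distrib, Finset.sum_add_distrib, Fintype.sum_prod_type (fun r => a₂ r.1),
      Fintype.sum_prod_type (fun r => a₃ r.2)]
    simp only [Finset.sum_const, Finset.card_univ, nsmul_eq_mul, ← Finset.mul_sum]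
    -- The marginal terms depend on one seed only, so summing over the other seed multiplies by its
    -- number of values.
    have c2 := mul_lt_mul_of_pos_left b2 h2
    have c3 := mul_lt_mul_of_pos_left b3 h1
    rw [hcard] at b1 ⊢
    linarith
  rw [inv_mul_lt_iff₀ (by rw [hcard]; positivity)]
  refine (((traceNorm_sum_le _ _ hJ).trans (Finset.sum_le_sum fun r _ => ?_))).trans_lt hbound
  refine (traceNorm_isometry_conj_le (adjoinBoth_isometry r) (hsum r)).trans ?_
  refine (traceNorm_add_le ((hE₁ r).add (hF₂ r.1)) (hF₃ r.2)).trans (add_le_add ?_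
    (traceNorm_mixed_kronecker_le (hE₃ r.2)))
  refine (traceNorm_add_le (hE₁ r) (hF₂ r.1)).trans (add_le_add le_rfl ?_)
  exact (traceNorm_submatrix_le _ (isHermitian_mixed_kronecker (hE₂ r.1))).trans
    (traceNorm_mixed_kronecker_le (hE₂ r.1))

end Main

end ConvexSplit

open ConvexSplit
-- The theorem
theorem mainTheorem13 {x y m : Type*} [Fintype x] [DecidableEq x] [Fintype y] [DecidableEq y]
    [Fintype m] [DecidableEq m]
    (ρ : Matrix (x × y × m) (x × y × m) ℂ) (hρ : IsSubnormalized ρ) (hρ0 : ρ ≠ 0)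
    (A B : ℕ) (hA : 0 < A) (hB : 0 < B) (ε : ℝ) (hε0 : 0 < ε) (hε1 : ε < 1)
    (V : Fin A → Matrix (x × Four x) (x × Four x) ℂ) (hV : IsHashDesignFamily V)
    (W : Fin B → Matrix (y × Four y) (y × Four y) ℂ) (hW : IsHashDesignFamily W)
    (hXM : smoothRenyiTwo ε (marginalXM ρ) (mixed x ⊗ₖ marginalM ρ) + log2 ((ε ^ 2)⁻¹)
      < log2 A)
    (hYM : smoothRenyiTwo ε (marginalYM ρ) (mixed y ⊗ₖ marginalM ρ) + log2 ((ε ^ 2)⁻¹)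
      < log2 B)
    (hXYM : smoothRenyiTwo ε ρ (mixed x ⊗ₖ (mixed y ⊗ₖ marginalM ρ)) + log2 ((ε ^ 2)⁻¹)
      < log2 A + log2 B) :
    traceNorm (convexSplitState V W ρ - decoupledState ρ)
        < 8 * ε * (ρ.trace.re + Real.sqrt ρ.trace.re) ∧
      (smoothRenyiTwo ε (marginalXM ρ) (mixed x ⊗ₖ marginalM ρ) + log2 ((ε ^ 2)⁻¹)
          + log2 (ρ.trace.re)⁻¹ < log2 A →
        smoothRenyiTwo ε (marginalYM ρ) (mixed y ⊗ₖ marginalM ρ) + log2 ((ε ^ 2)⁻¹)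
          + log2 (ρ.trace.re)⁻¹ < log2 B →
        smoothRenyiTwo ε ρ (mixed x ⊗ₖ (mixed y ⊗ₖ marginalM ρ)) + log2 ((ε ^ 2)⁻¹)
          + log2 (ρ.trace.re)⁻¹ < log2 A + log2 B →
        traceNorm (convexSplitState V W ρ - decoupledState ρ) < 16 * ε * ρ.trace.re) := by
  have htr := re_trace_pos hρ.1 hρ0
  have hε2 : 0 < ε ^ 2 := pow_pos hε0 2
  refine ⟨?_, fun hXM' hYM' hXYM' => ?_⟩
  -- With c = ε² the second error term is ε √(Tr ρ).
  · have := traceNorm_convexSplitState_sub_lt ρ hρ.1 htr hA hB hε2 hV hW hXM hYM hXYM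
    rw [Real.sqrt_sq hε0.le] at this
    exact this.trans_eq (by ring)
  -- The extra logarithm amounts to c = ε² Tr ρ, for which both error terms equal ε Tr ρ.
  · have hlog : log2 (ε ^ 2 * ρ.trace.re)⁻¹ = log2 ((ε ^ 2)⁻¹) + log2 (ρ.trace.re)⁻¹ := by
      rw [mul_inv, log2_mul (inv_pos.2 hε2) (inv_pos.2 htr)]
    rw [add_assoc, ← hlog] at hXM' hYM' hXYM'
    have := traceNorm_convexSplitState_sub_lt ρ hρ.1 htr hA hB (mul_pos hε2 htr) hV hW
      hXM' hYM' hXYM'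
    rw [Real.sqrt_mul hε2.le, Real.sqrt_sq hε0.le, mul_left_comm (Real.sqrt _),
      Real.mul_self_sqrt htr.le] at this
    exact this.trans_eq (by ring)
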